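/- Let $0 \le m < n$ be integers and let $M$ be a compact smooth Riemannian $n$-manifold without boundary whose universal cover $p : X \to M$, equipped with the lifted Riemannian metric, is homeomorphic to $\mathbb{R}^n$. An \emph{$m$-bubble cluster} in $M$ is a decomposition of $M$ into $m+1$ closed regions $R_0, R_1, \dots, R_m$ (empty regions and regions of volume zero are allowed) that cover $M$, have pairwise disjoint interiors, and have finite total wall area $A(R) = \mathcal{H}^{n-1}\bigl(\bigcup_{i=0}^m \partial R_i\bigr)$; the bubbles are $R_1, \dots, R_m$, and $R_0$ is the exterior. The cluster is \emph{minimizing} if $A(R) \le A(R')$ for every $m$-bubble cluster $R'$ with $\operatorname{vol}(R'_i) = \operatorname{vol}(R_i)$ for all $1 \le i \le m$. The cluster is a \emph{tiling} if its lift to the universal cover decomposes $X$ into pieces of finite diameter; that is, for every $0 \le i \le m$, every connected component of $p^{-1}(R_i)$ has finite diameter in the Riemannian distance of $X$. Then no minimizing $m$-bubble cluster in $M$ is a tiling. -/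

import Mathlib

open Set MeasureTheory Bundle Manifold
open scoped ContDiff ENNReal Topology

section Clusters

variable {M : Type*} [MetricSpace M] [MeasurableSpace M] [BorelSpace M]

/-- The `n`-dimensional Riemannian volume, as the (Euclidean-normalised) `n`-dimensional Hausdorff
measure of the Riemannian distance. -/
noncomputable def volumeOf (n : ℕ) (S : Set M) : ℝ≥0∞ := μHE[n] S

/-- The total area of the walls of a family of regions: the `(n - 1)`-dimensional Hausdorff measure
of the union of their boundaries. A wall between two regions is counted once. -/
noncomputable def wallArea (n : ℕ) {m : ℕ} (R : Fin (m + 1) → Set M) : ℝ≥0∞ :=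
  μHE[n - 1] (⋃ i, frontier (R i))

/-- An `m`-bubble cluster in a closed `n`-manifold: a decomposition of `M` into `m + 1` closed
regions with disjoint interiors and finite total wall area. The bubbles are `R 1, …, R m`, and
`R 0` is the exterior. -/
structure IsBubbleCluster (n m : ℕ) (R : Fin (m + 1) → Set M) : Prop where
  isClosed : ∀ i, IsClosed (R i)
  iUnion_eq : ⋃ i, R i = univ
  disjoint_interior : Pairwise fun i j => Disjoint (interior (R i)) (interior (R j))
  wallArea_ne_top : wallArea n R ≠ ⊤

/-- A minimizing `m`-bubble cluster: it has least wall area among all the `m`-bubble clusters whose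
bubbles have the same volumes. -/
structure IsMinimizingBubbleCluster (n m : ℕ) (R : Fin (m + 1) → Set M) : Prop where
  isBubbleCluster : IsBubbleCluster n m R
  wallArea_le : ∀ R' : Fin (m + 1) → Set M, IsBubbleCluster n m R' →
    (∀ i : Fin m, volumeOf n (R' i.succ) = volumeOf n (R i.succ)) → wallArea n R ≤ wallArea n R'

end Clusters

/-- The pieces of the lift of a family of regions along `p : X → M`: the connected components of
the preimages of the regions. -/
def liftedPieces {X M : Type*} [TopologicalSpace X] (p : X → M) {m : ℕ}
    (R : Fin (m + 1) → Set M) : Set (Set X) :=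
  {P | ∃ i, ∃ x ∈ p ⁻¹' R i, P = connectedComponentIn (p ⁻¹' R i) x}

/-- The family is a tiling if all the pieces of its lift along `p` have finite diameter. (If the
regions cover `M`, then the pieces cover `X`.) -/
def IsTiling {X M : Type*} [MetricSpace X] (p : X → M) {m : ℕ}
    (R : Fin (m + 1) → Set M) : Prop :=
  ∀ P ∈ liftedPieces p R, Metric.ediam P < ⊤

/-- `p : X → M` is the universal Riemannian covering of `M`: a covering map with simply connected
total space that is smooth and isometric on each tangent space, so that the metric of `X` is the
lifted one. -/
structure IsUniversalRiemannianCover (n : ℕ) {X M : Type*}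
    [TopologicalSpace X] [ChartedSpace (EuclideanSpace ℝ (Fin n)) X]
    [RiemannianBundle (fun x : X => TangentSpace (𝓡 n) x)]
    [TopologicalSpace M] [ChartedSpace (EuclideanSpace ℝ (Fin n)) M]
    [RiemannianBundle (fun x : M => TangentSpace (𝓡 n) x)] (p : X → M) : Prop where
  simplyConnectedSpace : SimplyConnectedSpace X
  isCoveringMap : IsCoveringMap p
  surjective : Function.Surjective p
  contMDiff : ContMDiff (𝓡 n) (𝓡 n) ∞ p
  norm_mfderiv : ∀ (x : X) (v : TangentSpace (𝓡 n) x), ‖mfderiv (𝓡 n) (𝓡 n) p x v‖ = ‖v‖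

/-!
The theorem comes from the fact that no cover of `M` by `m + 1 ≤ n` closed sets lifts to a cover of
`X` by sets with bounded components. This is a coarse form of the Lebesgue covering theorem: `ℝⁿ`,
with a proper metric having a cocompact isometry group, is not the union of `n` closed invariant
sets with bounded components, even though the metric may be unrelated to the Euclidean one.

*Geometry.* Deck transformations of `X` are `C¹` by the inverse function theorem and preserve the
norms of tangent vectors, hence are isometries (`IsUniversalRiemannianCover.exists_deck_isometry`);
since `M` is compact, they act cocompactly. As distances are infima of lengths of paths, `X` is
proper (`properSpace_of_cocompact`).

*Pieces.* A bounded component of a closed set has a bounded relatively clopen neighbourhood, and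
cocompactness makes the bound uniform (`exists_uniform_bound_clopen`). Hence on a large ball there
is a labelling `f` of points by points at distance at most `R₀`, with `R₀` independent of the ball,
such that sufficiently close points lying in the same set have the same label.

*Topology.* Chains are modulo two; they are spanned by finite lists of points, and a chain is fine
if the entries of each list are close to each other. The straight contraction of `ℝⁿ`, moved around
by isometries, shows that fine cycles bound fine chains within a controlled distance, uniformly in
`X` (`ListChain.exists_uniformlyAcyclic`). By induction on the dimension
(`ListChain.exists_controlled_extension`) one gets a chain map `ψ` which realizes finite sets of
labels by fine chains, and a chain homotopy `Γ` between `ψ ∘ f` and the identity, both moving points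
a bounded amount.

Let `b` be a fine subdivision of a huge simplex around the origin, and let `χ` count, modulo two,
the simplices with all the labels `0, …, n` of a Sperner labelling. Then `χ b = 1` by Sperner's
lemma, `χ` vanishes on boundaries, and it vanishes on fine chains away from the origin. In
`b = ψ (f b) + ∂ (Γ b) + Γ (∂ b)`, the chain `Γ (∂ b)` is away from the origin. As for `ψ (f b)`,
a small simplex near the origin has `n + 1` vertices in at most `n` sets, so that two of its
vertices have the same label and it does not contribute, while the other simplices contribute
chains away from the origin. So `χ b = 0`, a contradiction (`not_exists_bounded_colouring`).
-/

/-! ### Ordered chains modulo two -/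

/-- Chains modulo two spanned by the finite lists of points of `X`. A list with `k + 1` entries
stands for an ordered (possibly degenerate) `k`-simplex, and the empty list for the augmentation. -/
abbrev ListChain (X : Type*) := List X →₀ ZMod 2

namespace ListChain

variable {X Y Z : Type*}

/-- The cone with apex `v`: prepend `v` to every list. -/
noncomputable def cone (v : X) : ListChain X →ₗ[ZMod 2] ListChain X :=
  Finsupp.lmapDomain _ _ (List.cons v)

@[simp] lemma cone_single (v : X) (l : List X) (a : ZMod 2) :
    cone v (Finsupp.single l a) = Finsupp.single (v :: l) a := by
  simp [cone]

/-- The boundary of a list, by recursion on the list: it is the sum of the lists with one entry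
deleted. -/
noncomputable def listBoundary : List X → ListChain X
  | [] => 0
  | v :: l => Finsupp.single l 1 + cone v (listBoundary l)

/-- The boundary of a chain. -/
noncomputable def boundary : ListChain X →ₗ[ZMod 2] ListChain X :=
  Finsupp.linearCombination _ listBoundary

lemma boundary_single (l : List X) : boundary (Finsupp.single l 1) = listBoundary l := by
  simp [boundary]

@[simp] lemma boundary_nil : boundary (Finsupp.single ([] : List X) 1) = 0 := by
  simp [boundary, listBoundary]

/-- Two linear maps on chains agree if they agree on lists. -/
lemma hom_ext {V : Type*} [AddCommMonoid V] [Module (ZMod 2) V] {ι : Type*}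
    {f g : (ι →₀ ZMod 2) →ₗ[ZMod 2] V}
    (h : ∀ i, f (Finsupp.single i 1) = g (Finsupp.single i 1)) : f = g := by
  apply Finsupp.lhom_ext'
  intro i
  apply LinearMap.ext_ring
  simpa using h i

lemma boundary_cone (v : X) (c : ListChain X) :
    boundary (cone v c) = c + cone v (boundary c) := by
  have : boundary ∘ₗ cone v = LinearMap.id + cone v ∘ₗ boundary := by
    apply hom_ext
    intro l
    simp [boundary_single, listBoundary]
  exact LinearMap.congr_fun this c

lemma boundary_boundary (c : ListChain X) : boundary (boundary c) = 0 := by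
  have : boundary ∘ₗ boundary = (0 : ListChain X →ₗ[ZMod 2] ListChain X) := by
    apply hom_ext
    intro l
    induction l with
    | nil => simp
    | cons v l ih =>
      have h1 : Finsupp.single (v :: l) (1 : ZMod 2) = cone v (Finsupp.single l 1) := by simp
      rw [h1]
      simp only [LinearMap.comp_apply, LinearMap.zero_apply] at ih ⊢
      rw [boundary_cone, map_add, boundary_cone, ih, map_zero, add_zero, ZModModule.add_self]
  exact LinearMap.congr_fun this c

/-- The chain map induced by a map of points. -/
noncomputable def push (f : X → Y) : ListChain X →ₗ[ZMod 2] ListChain Y :=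
  Finsupp.lmapDomain _ _ (List.map f)

@[simp] lemma push_single (f : X → Y) (l : List X) (a : ZMod 2) :
    push f (Finsupp.single l a) = Finsupp.single (l.map f) a := by
  simp [push]

lemma push_cone (f : X → Y) (v : X) (c : ListChain X) :
    push f (cone v c) = cone (f v) (push f c) := by
  have : push f ∘ₗ cone v = cone (f v) ∘ₗ push f := by
    apply hom_ext
    intro l
    simp
  exact LinearMap.congr_fun this c

lemma boundary_push (f : X → Y) (c : ListChain X) :
    boundary (push f c) = push f (boundary c) := by
  have : boundary ∘ₗ push f = push f ∘ₗ boundary := by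
    apply hom_ext
    intro l
    induction l with
    | nil => simp
    | cons v l ih =>
      have h1 : Finsupp.single (v :: l) (1 : ZMod 2) = cone v (Finsupp.single l 1) := by simp
      rw [h1]
      simp only [LinearMap.comp_apply] at ih ⊢
      rw [push_cone, boundary_cone, boundary_cone, map_add, push_cone, ih]
  exact LinearMap.congr_fun this c

lemma push_push (g : Y → Z) (f : X → Y) (c : ListChain X) :
    push g (push f c) = push (g ∘ f) c := by
  have : push g ∘ₗ push f = push (g ∘ f) := by
    apply hom_ext
    intro l
    simp
  exact LinearMap.congr_fun this c

lemma push_id (c : ListChain X) : push id c = c := by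
  have : push (id : X → X) = LinearMap.id := by
    apply hom_ext
    intro l
    simp
  exact LinearMap.congr_fun this c

/-- The prism over a list, with bottom `f` and top `g`, by recursion on the list. -/
noncomputable def listPrism (f g : X → Y) : List X → ListChain Y
  | [] => 0
  | v :: l => Finsupp.single (f v :: g v :: l.map g) 1 + cone (f v) (listPrism f g l)

/-- The prism operator, a chain homotopy between `push f` and `push g`. -/
noncomputable def prism (f g : X → Y) : ListChain X →ₗ[ZMod 2] ListChain Y :=
  Finsupp.linearCombination _ (listPrism f g)

lemma prism_single (f g : X → Y) (l : List X) :
    prism f g (Finsupp.single l 1) = listPrism f g l := by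
  simp [prism]

lemma prism_cone (f g : X → Y) (v : X) (c : ListChain X) :
    prism f g (cone v c) = cone (f v) (cone (g v) (push g c)) + cone (f v) (prism f g c) := by
  have : prism f g ∘ₗ cone v =
      cone (f v) ∘ₗ cone (g v) ∘ₗ push g + cone (f v) ∘ₗ prism f g := by
    apply hom_ext
    intro l
    simp [prism_single, listPrism]
  exact LinearMap.congr_fun this c

lemma boundary_prism (f g : X → Y) (c : ListChain X) :
    boundary (prism f g c) = push f c + push g c + prism f g (boundary c) := by
  have : boundary ∘ₗ prism f g = push f + push g + prism f g ∘ₗ boundary := by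
    apply hom_ext
    intro l
    induction l with
    | nil => simp [prism_single, listPrism, ZModModule.add_self]
    | cons v l ih =>
      have h1 : Finsupp.single (v :: l) (1 : ZMod 2) = cone v (Finsupp.single l 1) := by simp
      rw [h1]
      set c : ListChain X := Finsupp.single l 1
      simp only [LinearMap.comp_apply, LinearMap.add_apply] at ih ⊢
      rw [prism_cone, map_add, boundary_cone, boundary_cone, boundary_cone, ih, boundary_cone,
        map_add (prism f g), prism_cone, push_cone, push_cone, boundary_push]
      simp only [map_add]
      have e (x y : ListChain Y) : x = y ↔ x + y = 0 := by
        rw [← ZModModule.sub_eq_add, sub_eq_zero]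
      rw [e]
      have h2 (x : ListChain Y) : (2 : ℤ) • x = 0 := by
        rw [two_smul, ZModModule.add_self]
      abel_nf
      simp [h2]
  exact LinearMap.congr_fun this c

end ListChain

/-! ### Unordered chains modulo two -/

/-- Chains modulo two spanned by the finite sets of elements of `V`, viewed as unordered simplices;
the empty set is the augmentation. -/
abbrev FinsetChain (V : Type*) := Finset V →₀ ZMod 2

namespace FinsetChain

variable {V : Type*} [DecidableEq V]

/-- Insertion of a vertex; a set which already contains the vertex is sent to zero. -/
noncomputable def ins (v : V) : FinsetChain V →ₗ[ZMod 2] FinsetChain V :=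
  Finsupp.linearCombination _ fun s => if v ∈ s then 0 else Finsupp.single (insert v s) 1

/-- The boundary: the sum of the sets with one element removed. -/
noncomputable def boundary : FinsetChain V →ₗ[ZMod 2] FinsetChain V :=
  Finsupp.linearCombination _ fun s => ∑ a ∈ s, Finsupp.single (s.erase a) 1

lemma ins_single (v : V) (s : Finset V) :
    ins v (Finsupp.single s 1) = if v ∈ s then 0 else Finsupp.single (insert v s) 1 := by
  simp [ins]

lemma boundary_single (s : Finset V) :
    boundary (Finsupp.single s 1) = ∑ a ∈ s, Finsupp.single (s.erase a) (1 : ZMod 2) := by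
  simp [boundary]

lemma boundary_ins (v : V) (c : FinsetChain V) :
    boundary (ins v c) = c + ins v (boundary c) := by
  have : boundary ∘ₗ ins v = LinearMap.id + ins v ∘ₗ boundary := by
    apply ListChain.hom_ext
    intro s
    simp only [LinearMap.comp_apply, LinearMap.add_apply, LinearMap.id_apply, boundary_single,
      map_sum, ins_single]
    split_ifs with h
    · have : ∑ x ∈ s, (if v ∈ s.erase x then (0 : FinsetChain V)
          else Finsupp.single (insert v (s.erase x)) 1) = Finsupp.single s 1 := by
        rw [Finset.sum_eq_single_of_mem v h]
        · simp [h]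
        · intro b _ hb
          simp [h, hb.symm]
      rw [this, ZModModule.add_self, map_zero]
    · rw [boundary_single, Finset.sum_insert h, Finset.erase_insert h]
      congr 1
      apply Finset.sum_congr rfl
      intro x hx
      have hxv : v ≠ x := fun e => h (e ▸ hx)
      simp [h, Finset.erase_insert_of_ne hxv]
  exact LinearMap.congr_fun this c

lemma boundary_boundary (c : FinsetChain V) : boundary (boundary c) = 0 := by
  have : boundary ∘ₗ boundary = (0 : FinsetChain V →ₗ[ZMod 2] FinsetChain V) := by
    apply ListChain.hom_ext
    intro s
    induction s using Finset.induction_on with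
    | empty => simp [boundary_single]
    | insert v s hv ih =>
      have h1 : Finsupp.single (insert v s) (1 : ZMod 2) = ins v (Finsupp.single s 1) := by
        simp [ins_single, hv]
      rw [h1]
      simp only [LinearMap.comp_apply, LinearMap.zero_apply] at ih ⊢
      rw [boundary_ins, map_add, boundary_ins, ih, map_zero, add_zero, ZModModule.add_self]
  exact LinearMap.congr_fun this c

/-- Forgetting the order of a list. A list with a repeated entry is sent to zero. -/
noncomputable def ofList : ListChain V →ₗ[ZMod 2] FinsetChain V :=
  Finsupp.linearCombination _ fun l => if l.Nodup then Finsupp.single l.toFinset 1 else 0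

lemma ofList_single (l : List V) :
    ofList (Finsupp.single l 1) = if l.Nodup then Finsupp.single l.toFinset 1 else 0 := by
  simp [ofList]

lemma ofList_cone (v : V) (c : ListChain V) :
    ofList (ListChain.cone v c) = ins v (ofList c) := by
  have : ofList ∘ₗ ListChain.cone v = ins v ∘ₗ ofList := by
    apply ListChain.hom_ext
    intro l
    by_cases hl : l.Nodup <;> by_cases hv : v ∈ l <;>
      simp [ofList_single, ins_single, hl, hv]
  exact LinearMap.congr_fun this c

/-- Forgetting the order is a chain map; modulo two, the faces of a list with a repeated entry
cancel. -/
lemma boundary_ofList (c : ListChain V) :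
    boundary (ofList c) = ofList (ListChain.boundary c) := by
  have : boundary ∘ₗ ofList = ofList ∘ₗ (ListChain.boundary : ListChain V →ₗ[ZMod 2] _) := by
    apply ListChain.hom_ext
    intro l
    induction l with
    | nil => simp [ofList_single, boundary_single]
    | cons v l ih =>
      have h1 : Finsupp.single (v :: l) (1 : ZMod 2) = ListChain.cone v (Finsupp.single l 1) := by
        simp
      rw [h1]
      simp only [LinearMap.comp_apply] at ih ⊢
      rw [ofList_cone, boundary_ins, ListChain.boundary_cone, map_add, ofList_cone, ih]
  exact LinearMap.congr_fun this c

end FinsetChain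

/-! ### Fine chains and their fillings -/

/-- A linear map sends the chains supported in `s` into `W` if it does so for the generators. -/
lemma Finsupp.map_mem_of_mem_supported {ι V : Type*} [AddCommMonoid V] [Module (ZMod 2) V]
    {s : Set ι} {c : ι →₀ ZMod 2} (hc : c ∈ Finsupp.supported (ZMod 2) (ZMod 2) s)
    (T : (ι →₀ ZMod 2) →ₗ[ZMod 2] V) (W : Submodule (ZMod 2) V)
    (h : ∀ i ∈ s, T (Finsupp.single i 1) ∈ W) : T c ∈ W := by
  rw [Finsupp.supported_eq_span_single] at hc
  have : Submodule.span (ZMod 2) ((fun i => Finsupp.single i (1 : ZMod 2)) '' s) ≤ W.comap T := by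
    rw [Submodule.span_le]
    rintro _ ⟨i, hi, rfl⟩
    exact h i hi
  exact this hc

namespace ListChain

variable {X Y : Type*}

lemma listBoundary_mem (l : List X) : listBoundary l ∈ Finsupp.supported (ZMod 2) (ZMod 2)
    {l' : List X | l'.length + 1 = l.length ∧ ∀ x ∈ l', x ∈ l} := by
  induction l with
  | nil => exact zero_mem _
  | cons v l ih =>
    refine add_mem (Finsupp.single_mem_supported _ _ ⟨rfl, fun x hx => List.mem_cons_of_mem _ hx⟩) ?_
    refine Finsupp.map_mem_of_mem_supported ih _ _ fun l' hl' => ?_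
    rw [cone_single]
    refine Finsupp.single_mem_supported _ _ ⟨by simpa using hl'.1, fun x hx => ?_⟩
    rcases List.mem_cons.1 hx with rfl | hx
    · exact List.mem_cons_self
    · exact List.mem_cons_of_mem _ (hl'.2 x hx)

lemma listPrism_mem (f g : X → Y) (l : List X) :
    listPrism f g l ∈ Finsupp.supported (ZMod 2) (ZMod 2)
      {l' : List Y | l'.length = l.length + 1 ∧ ∀ y ∈ l', ∃ x ∈ l, y = f x ∨ y = g x} := by
  induction l with
  | nil => exact zero_mem _
  | cons v l ih =>
    refine add_mem (Finsupp.single_mem_supported _ _ ⟨by simp, fun y hy => ?_⟩) ?_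
    · simp only [List.mem_cons, List.mem_map] at hy
      rcases hy with rfl | rfl | ⟨x, hx, rfl⟩
      · exact ⟨v, by simp, Or.inl rfl⟩
      · exact ⟨v, by simp, Or.inr rfl⟩
      · exact ⟨x, by simp [hx], Or.inr rfl⟩
    refine Finsupp.map_mem_of_mem_supported ih _ _ fun l' hl' => ?_
    rw [cone_single]
    refine Finsupp.single_mem_supported _ _ ⟨by simpa using hl'.1, fun y hy => ?_⟩
    rcases List.mem_cons.1 hy with rfl | hy
    · exact ⟨v, by simp, Or.inl rfl⟩
    · obtain ⟨x, hx, h⟩ := hl'.2 y hy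
      exact ⟨x, List.mem_cons_of_mem _ hx, h⟩

variable [MetricSpace X] [MetricSpace Y]

/-- The chains spanned by the lists with `k` entries in `S` whose entries are pairwise at distance
at most `ε`. -/
noncomputable def fine (k : ℕ) (ε : ℝ) (S : Set X) : Submodule (ZMod 2) (ListChain X) :=
  Finsupp.supported (ZMod 2) (ZMod 2)
    {l | l.length = k ∧ (∀ x ∈ l, x ∈ S) ∧ ∀ x ∈ l, ∀ y ∈ l, dist x y ≤ ε}

lemma single_mem_fine {k : ℕ} {ε : ℝ} {S : Set X} {l : List X} (h1 : l.length = k)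
    (h2 : ∀ x ∈ l, x ∈ S) (h3 : ∀ x ∈ l, ∀ y ∈ l, dist x y ≤ ε) (a : ZMod 2) :
    Finsupp.single l a ∈ fine k ε S :=
  Finsupp.single_mem_supported _ _ ⟨h1, h2, h3⟩

lemma fine_mono {k : ℕ} {ε ε' : ℝ} {S S' : Set X} (hε : ε ≤ ε') (hS : S ⊆ S') :
    fine k ε S ≤ fine k ε' S' :=
  Finsupp.supported_mono fun _ hl =>
    ⟨hl.1, fun x hx => hS (hl.2.1 x hx), fun x hx y hy => (hl.2.2 x hx y hy).trans hε⟩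

lemma map_mem_of_mem_fine {V : Type*} [AddCommMonoid V] [Module (ZMod 2) V]
    {k : ℕ} {ε : ℝ} {S : Set X} {c : ListChain X} (hc : c ∈ fine k ε S)
    (T : ListChain X →ₗ[ZMod 2] V) (W : Submodule (ZMod 2) V)
    (h : ∀ l : List X, l.length = k → (∀ x ∈ l, x ∈ S) → (∀ x ∈ l, ∀ y ∈ l, dist x y ≤ ε) →
      T (Finsupp.single l 1) ∈ W) : T c ∈ W :=
  Finsupp.map_mem_of_mem_supported hc T W fun l hl => h l hl.1 hl.2.1 hl.2.2

lemma push_mem_fine {k : ℕ} {ε ε' : ℝ} {S : Set X} {S' : Set Y} {c : ListChain X}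
    (hc : c ∈ fine k ε S) {f : X → Y} (hf : MapsTo f S S')
    (hf' : ∀ x ∈ S, ∀ y ∈ S, dist x y ≤ ε → dist (f x) (f y) ≤ ε') :
    push f c ∈ fine k ε' S' := by
  refine map_mem_of_mem_fine hc _ _ fun l h1 h2 h3 => ?_
  rw [push_single]
  apply single_mem_fine
  · simpa using h1
  · simp only [List.mem_map]
    rintro _ ⟨x, hx, rfl⟩
    exact hf (h2 x hx)
  · simp only [List.mem_map]
    rintro _ ⟨x, hx, rfl⟩ _ ⟨y, hy, rfl⟩
    exact hf' x (h2 x hx) y (h2 y hy) (h3 x hx y hy)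

lemma prism_mem_fine {k : ℕ} {ε ε' : ℝ} {S : Set X} {S' : Set Y} {c : ListChain X}
    (hc : c ∈ fine k ε S) {f g : X → Y} (hf : MapsTo f S S') (hg : MapsTo g S S')
    (hff : ∀ x ∈ S, ∀ y ∈ S, dist x y ≤ ε → dist (f x) (f y) ≤ ε')
    (hfg : ∀ x ∈ S, ∀ y ∈ S, dist x y ≤ ε → dist (f x) (g y) ≤ ε')
    (hgg : ∀ x ∈ S, ∀ y ∈ S, dist x y ≤ ε → dist (g x) (g y) ≤ ε') :
    prism f g c ∈ fine (k + 1) ε' S' := by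
  refine map_mem_of_mem_fine hc _ _ fun l h1 h2 h3 => ?_
  rw [prism_single]
  refine Finsupp.supported_mono ?_ (listPrism_mem f g l)
  rintro l' ⟨h4, h5⟩
  refine ⟨by omega, fun y hy => ?_, fun y hy z hz => ?_⟩
  · obtain ⟨x, hx, rfl | rfl⟩ := h5 y hy
    · exact hf (h2 x hx)
    · exact hg (h2 x hx)
  · obtain ⟨a, ha, rfl | rfl⟩ := h5 y hy <;> obtain ⟨b, hb, rfl | rfl⟩ := h5 z hz
    · exact hff a (h2 a ha) b (h2 b hb) (h3 a ha b hb)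
    · exact hfg a (h2 a ha) b (h2 b hb) (h3 a ha b hb)
    · rw [dist_comm]
      exact hfg b (h2 b hb) a (h2 a ha) (h3 b hb a ha)
    · exact hgg a (h2 a ha) b (h2 b hb) (h3 a ha b hb)

/-- A contraction of `X` which moves the compact set `Q` inside `S` allows one to fill cycles in
`Q` by chains in `S`, with control of the fineness: the filling consists of the prisms between
consecutive stages of the contraction, and of a final degenerate cone. -/
theorem exists_filling_of_contraction {Q S : Set X} (hQ : IsCompact Q) {H : ℝ × X → X}
    (hH : Continuous H) {q : X} (hq : q ∈ S) (h0 : ∀ x, H (0, x) = x) (h1 : ∀ x, H (1, x) = q)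
    (hS : ∀ t ∈ Icc (0 : ℝ) 1, ∀ x ∈ Q, H (t, x) ∈ S) {ε : ℝ} (hε : 0 < ε) :
    ∃ δ > 0, ∀ (k : ℕ), ∀ z ∈ fine k δ Q, boundary z = 0 →
      ∃ w ∈ fine (k + 1) ε S, boundary w = z := by
  have hU : UniformContinuousOn H (Icc (0 : ℝ) 1 ×ˢ Q) :=
    (isCompact_Icc.prod hQ).uniformContinuousOn_of_continuous hH.continuousOn
  obtain ⟨δ, hδ, hU⟩ := Metric.uniformContinuousOn_iff_le.1 hU ε hε
  refine ⟨δ, hδ, fun k z hz hbz => ?_⟩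
  obtain ⟨N, hN⟩ := exists_nat_gt (1 / δ)
  have hN0 : (0 : ℝ) < N := (by positivity : 0 < 1 / δ).trans hN
  have hN0' : (N : ℝ) ≠ 0 := hN0.ne'
  have hNδ : 1 / (N : ℝ) ≤ δ := by
    rw [div_lt_iff₀ hδ] at hN
    rw [div_le_iff₀ hN0]
    linarith
  let h : ℕ → X → X := fun j x => H (j / N, x)
  have hI : ∀ j ≤ N, (j / N : ℝ) ∈ Icc (0 : ℝ) 1 := fun j hj =>
    ⟨by positivity, (div_le_one hN0).2 (by exact_mod_cast hj)⟩
  have hstage : ∀ i ≤ N, ∀ j ≤ N, |(i : ℝ) - j| ≤ 1 → ∀ x ∈ Q, ∀ y ∈ Q, dist x y ≤ δ →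
      dist (h i x) (h j y) ≤ ε := by
    intro i hi j hj hij x hx y hy hxy
    refine hU _ ⟨hI i hi, hx⟩ _ ⟨hI j hj, hy⟩ ?_
    rw [Prod.dist_eq, max_le_iff]
    refine ⟨?_, hxy⟩
    rw [Real.dist_eq, ← sub_div, abs_div, abs_of_pos hN0]
    exact (div_le_div_of_nonneg_right hij hN0.le).trans hNδ
  have hmaps : ∀ j ≤ N, MapsTo (h j) Q S := fun j hj x hx => hS _ (hI j hj) x hx
  have hstep : ∀ j < N, prism (h j) (h (j + 1)) z ∈ fine (k + 1) ε S := by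
    intro j hj
    refine prism_mem_fine hz (hmaps j hj.le) (hmaps (j + 1) hj) ?_ ?_ ?_
    · exact hstage j hj.le j hj.le (by simp)
    · exact hstage j hj.le (j + 1) hj (by push_cast; simp)
    · exact hstage (j + 1) hj (j + 1) hj (by simp)
  have hlast : cone q (push (h N) z) ∈ fine (k + 1) ε S := by
    have : (cone q ∘ₗ push (h N)) z ∈ fine (k + 1) ε S := by
      refine map_mem_of_mem_fine hz _ _ fun l h2 h3 h4 => ?_
      have hconst : ∀ x ∈ q :: l.map (h N), x = q := by
        simp only [List.mem_cons, List.mem_map]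
        rintro x (rfl | ⟨y, -, rfl⟩)
        · rfl
        · simp only [h]
          rw [div_self hN0', h1]
      simp only [LinearMap.comp_apply, push_single, cone_single]
      apply single_mem_fine
      · simpa using h2
      · intro x hx
        rw [hconst x hx]
        exact hq
      · intro x hx y hy
        rw [hconst x hx, hconst y hy, dist_self]
        exact hε.le
    exact this
  refine ⟨∑ j ∈ Finset.range N, prism (h j) (h (j + 1)) z + cone q (push (h N) z),
    add_mem (sum_mem fun j hj => hstep j (Finset.mem_range.1 hj)) hlast, ?_⟩
  have htel : ∀ K, boundary (∑ j ∈ Finset.range K, prism (h j) (h (j + 1)) z)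
      = push (h 0) z + push (h K) z := by
    intro K
    induction K with
    | zero => simp [ZModModule.add_self]
    | succ K ih =>
      rw [Finset.sum_range_succ, map_add, ih, boundary_prism, hbz, map_zero, add_zero,
        add_assoc, ← add_assoc (push (h K) z), ZModModule.add_self, zero_add]
  have hid : push (h 0) z = z := by
    have : h 0 = id := by
      funext x
      simp [h, h0]
    rw [this, push_id]
  rw [map_add, htel, hid, boundary_cone, boundary_push, hbz, map_zero, map_zero, add_zero,
    add_assoc, ZModModule.add_self, add_zero]

/-- Acyclic carriers. Let `ι` index the generators of a complex with differential `D`, graded by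
`deg`, and let `Φ i` be a carrier for the generator `i`. If fine cycles in the reduced carrier
`Φ' i` can be filled in `Φ i`, then a map `e` from the complex to chains of points which commutes
with the differentials is null-homotopic in a controlled way, as soon as a null homotopy is
prescribed in degree `0`. The chains produced in degree `k` consist of lists with `k + a`
entries. -/
theorem exists_controlled_extension {ι : Type*} (deg : ι → ℕ) (a : ℕ)
    (D : (ι →₀ ZMod 2) →ₗ[ZMod 2] (ι →₀ ZMod 2)) (hDD : ∀ c, D (D c) = 0)
    (G₀ : Set ι) (Φ Φ' : ι → Set X)
    (hfill : ∀ k : ℕ, ∀ ε > 0, ∃ δ > 0, ∀ i ∈ G₀, deg i = k + 1 →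
      ∀ z ∈ fine (k + a) δ (Φ' i), boundary z = 0 →
        ∃ w ∈ fine (k + 1 + a) ε (Φ i), boundary w = z)
    (N : ℕ) : ∀ ε > 0, ∃ δ > 0, ∀ G ⊆ G₀,
      (∀ i ∈ G, ∀ k, deg i = k + 1 → D (Finsupp.single i 1) ∈ Finsupp.supported (ZMod 2) (ZMod 2)
        {j | j ∈ G ∧ deg j = k ∧ Φ j ⊆ Φ' i}) →
      ∀ (e : (ι →₀ ZMod 2) →ₗ[ZMod 2] ListChain X),
      (∀ i ∈ G, deg i ≤ N →
        boundary (e (Finsupp.single i 1)) = e (D (Finsupp.single i 1))) →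
      (∀ i ∈ G, ∀ k < N, deg i = k + 1 → e (Finsupp.single i 1) ∈ fine (k + a) δ (Φ' i)) →
      ∀ θ₀ : ι → ListChain X,
      (∀ i ∈ G, deg i = 0 → D (Finsupp.single i 1) = 0 ∧ (∀ η > 0, θ₀ i ∈ fine a η (Φ i)) ∧
        boundary (θ₀ i) = e (Finsupp.single i 1)) →
      ∃ Θ : (ι →₀ ZMod 2) →ₗ[ZMod 2] ListChain X,
        (∀ i ∈ G, deg i = 0 → Θ (Finsupp.single i 1) = θ₀ i) ∧
        ∀ i ∈ G, deg i ≤ N → Θ (Finsupp.single i 1) ∈ fine (deg i + a) ε (Φ i) ∧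
          boundary (Θ (Finsupp.single i 1)) =
            Θ (D (Finsupp.single i 1)) + e (Finsupp.single i 1) := by
  induction N with
  | zero =>
    intro ε hε
    refine ⟨1, one_pos, fun G hG hD e he hef θ₀ hθ₀ => ?_⟩
    refine ⟨Finsupp.linearCombination _ θ₀, fun i hi hdi => by simp, fun i hi hdi => ?_⟩
    have hdi : deg i = 0 := by omega
    obtain ⟨h1, h2, h3⟩ := hθ₀ i hi hdi
    rw [h1, map_zero, zero_add, hdi, zero_add]
    simpa using ⟨h2 ε hε, h3⟩
  | succ N ih =>
    intro ε hε
    obtain ⟨δ₁, hδ₁, hfill₁⟩ := hfill N ε hε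
    obtain ⟨δ₂, hδ₂, ih⟩ := ih (min ε δ₁) (lt_min hε hδ₁)
    refine ⟨min δ₂ δ₁, lt_min hδ₂ hδ₁, fun G hG hD e he hef θ₀ hθ₀ => ?_⟩
    obtain ⟨Θ, hΘ₀, hΘ⟩ := ih G hG hD e (fun i hi hdi => he i hi (by omega))
      (fun i hi k hkN hk =>
        fine_mono (min_le_left _ _) subset_rfl (hef i hi k (by omega) hk)) θ₀ hθ₀
    have hex : ∀ i, ∃ w, i ∈ G → deg i = N + 1 → w ∈ fine (N + 1 + a) ε (Φ i) ∧
        boundary w = Θ (D (Finsupp.single i 1)) + e (Finsupp.single i 1) := by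
      intro i
      by_cases hi : i ∈ G ∧ deg i = N + 1
      · obtain ⟨hi, hdi⟩ := hi
        have hDi := hD i hi N hdi
        have hz : Θ (D (Finsupp.single i 1)) + e (Finsupp.single i 1)
            ∈ fine (N + a) δ₁ (Φ' i) := by
          refine add_mem ?_ (fine_mono (min_le_right _ _) subset_rfl
            (hef i hi N N.lt_succ_self hdi))
          refine Finsupp.map_mem_of_mem_supported hDi _ _ fun j hj => ?_
          have := (hΘ j hj.1 hj.2.1.le).1
          rw [hj.2.1] at this
          exact fine_mono (min_le_right _ _) hj.2.2 this
        have hbz : boundary (Θ (D (Finsupp.single i 1)) + e (Finsupp.single i 1)) = 0 := by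
          have hcomm : (boundary ∘ₗ Θ + Θ ∘ₗ D + e) (D (Finsupp.single i 1)) ∈
              (⊥ : Submodule (ZMod 2) (ListChain X)) := by
            refine Finsupp.map_mem_of_mem_supported hDi _ _ fun j hj => ?_
            simp only [LinearMap.add_apply, LinearMap.comp_apply, Submodule.mem_bot]
            rw [(hΘ j hj.1 hj.2.1.le).2, add_assoc, ZModModule.add_self]
          simp only [LinearMap.add_apply, LinearMap.comp_apply, Submodule.mem_bot] at hcomm
          rw [hDD, map_zero, add_zero] at hcomm
          rw [map_add, he i hi hdi.le, hcomm]
        obtain ⟨w, hw, hbw⟩ := hfill₁ i (hG hi) hdi _ hz hbz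
        exact ⟨w, fun _ _ => ⟨hw, hbw⟩⟩
      · exact ⟨0, fun h1 h2 => absurd ⟨h1, h2⟩ hi⟩
    choose w hw using hex
    let Θ' : (ι →₀ ZMod 2) →ₗ[ZMod 2] ListChain X := Finsupp.linearCombination _
      fun i => if deg i ≤ N then Θ (Finsupp.single i 1) else w i
    have hle : ∀ i, deg i ≤ N → Θ' (Finsupp.single i 1) = Θ (Finsupp.single i 1) :=
      fun i hi => by simp [Θ', hi]
    have hgt : ∀ i, ¬ deg i ≤ N → Θ' (Finsupp.single i 1) = w i := fun i hi => by simp [Θ', hi]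
    -- the boundaries of generators of degree at most `N + 1` only involve degrees at most `N`
    have hD' : ∀ i ∈ G, deg i ≤ N + 1 →
        Θ' (D (Finsupp.single i 1)) = Θ (D (Finsupp.single i 1)) := by
      intro i hi hdi
      rcases Nat.eq_zero_or_pos (deg i) with h | h
      · simp [(hθ₀ i hi h).1]
      · obtain ⟨k, hk⟩ := Nat.exists_eq_add_of_lt h
        have hk' : deg i = k + 1 := by omega
        have : (Θ' + Θ) (D (Finsupp.single i 1)) ∈ (⊥ : Submodule (ZMod 2) (ListChain X)) := by
          refine Finsupp.map_mem_of_mem_supported (hD i hi k hk') _ _ fun j hj => ?_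
          have hj' : deg j ≤ N := by have := hj.2.1; omega
          rw [LinearMap.add_apply, hle j hj', Submodule.mem_bot, ZModModule.add_self]
        rw [Submodule.mem_bot, LinearMap.add_apply, ← ZModModule.sub_eq_add] at this
        exact sub_eq_zero.1 this
    refine ⟨Θ', fun i hi hdi => by rw [hle i (by omega), hΘ₀ i hi hdi], fun i hi hdi => ?_⟩
    rw [hD' i hi hdi]
    by_cases h : deg i ≤ N
    · rw [hle i h]
      exact ⟨fine_mono (min_le_left _ _) subset_rfl (hΘ i hi h).1, (hΘ i hi h).2⟩
    · have h' : deg i = N + 1 := by omega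
      rw [hgt i h, h']
      exact hw i hi h'

end ListChain

/-! ### Labellings of a large simplex -/

namespace ListChain

variable {X : Type*}

/-- Sperner's lemma for chains: if `sd` sends every simplex `I` to a chain whose vertices carry
labels in `I`, compatibly with the boundaries, then the labelling maps `sd I` back to `I`. -/
theorem ofList_push_of_labels_mem {V : Type*} [DecidableEq V] (lab : X → V)
    (sd : FinsetChain V →ₗ[ZMod 2] ListChain X)
    (h0 : sd (Finsupp.single ∅ 1) = Finsupp.single [] 1)
    (hsd : ∀ I : Finset V, sd (Finsupp.single I 1) ∈ Finsupp.supported (ZMod 2) (ZMod 2)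
      {l : List X | l.length = I.card ∧ ∀ x ∈ l, lab x ∈ I})
    (hbd : ∀ I : Finset V,
      boundary (sd (Finsupp.single I 1)) = sd (FinsetChain.boundary (Finsupp.single I 1)))
    (I : Finset V) :
    FinsetChain.ofList (push lab (sd (Finsupp.single I 1))) = Finsupp.single I 1 := by
  induction I using Finset.strongInduction with
  | H I ih =>
  rcases I.eq_empty_or_nonempty with rfl | hI
  · simp [h0, FinsetChain.ofList_single]
  have hmem : (FinsetChain.ofList ∘ₗ push lab) (sd (Finsupp.single I 1)) ∈
      Finsupp.supported (ZMod 2) (ZMod 2) {I} := by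
    refine Finsupp.map_mem_of_mem_supported (hsd I) _ _ fun l hl => ?_
    simp only [LinearMap.comp_apply, push_single, FinsetChain.ofList_single]
    split_ifs with hnd
    · refine Finsupp.single_mem_supported _ _ ?_
      -- a repetition-free list of `card I` labels in `I` exhausts `I`
      apply Finset.eq_of_subset_of_card_le
      · intro v hv
        simp only [List.mem_toFinset, List.mem_map] at hv
        obtain ⟨x, hx, rfl⟩ := hv
        exact hl.2 x hx
      · rw [List.toFinset_card_of_nodup hnd, List.length_map, hl.1]
    · exact zero_mem _
  obtain ⟨a, ha⟩ : ∃ a, FinsetChain.ofList (push lab (sd (Finsupp.single I 1)))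
      = Finsupp.single I a := by
    refine ⟨FinsetChain.ofList (push lab (sd (Finsupp.single I 1))) I, ?_⟩
    rw [Finsupp.mem_supported] at hmem
    exact Finsupp.eq_single_iff.2 ⟨by exact_mod_cast hmem, rfl⟩
  have hb : FinsetChain.boundary (FinsetChain.ofList (push lab (sd (Finsupp.single I 1))))
      = FinsetChain.boundary (Finsupp.single I 1) := by
    rw [FinsetChain.boundary_ofList, boundary_push, hbd, FinsetChain.boundary_single]
    simp only [map_sum]
    exact Finset.sum_congr rfl fun i hi => ih _ (Finset.erase_ssubset hi)
  obtain ⟨i, hi⟩ := hI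
  have hne : FinsetChain.boundary (Finsupp.single I (1 : ZMod 2)) ≠ 0 := by
    intro h
    rw [FinsetChain.boundary_single] at h
    have := DFunLike.congr_fun h (I.erase i)
    rw [Finsupp.finsetSum_apply, Finset.sum_eq_single_of_mem i hi] at this
    · simp at this
    · intro j hj hji
      rw [Finsupp.single_apply, if_neg]
      intro h'
      have : i ∈ I.erase j := Finset.mem_erase.2 ⟨hji.symm, hi⟩
      rw [h'] at this
      simp at this
  rw [ha] at hb ⊢
  rcases (by decide : ∀ a : ZMod 2, a = 0 ∨ a = 1) a with rfl | rfl
  · rw [Finsupp.single_zero, map_zero] at hb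
    exact absurd hb.symm hne
  · rfl

end ListChain

section Coordinates

variable {n : ℕ}

/-- The `n + 1` coordinates of a point of `ℝⁿ`: the usual ones, followed by the opposite of their
sum. They add up to zero, which makes the vertices of a simplex around the origin play symmetric
roles. -/
noncomputable def balancedCoord (y : EuclideanSpace ℝ (Fin n)) : Fin (n + 1) → ℝ :=
  Fin.lastCases (-∑ j, y j) (fun j => y j)

lemma sum_balancedCoord (y : EuclideanSpace ℝ (Fin n)) : ∑ i, balancedCoord y i = 0 := by
  simp [Fin.sum_univ_castSucc, balancedCoord]

lemma continuous_balancedCoord (i : Fin (n + 1)) :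
    Continuous fun y : EuclideanSpace ℝ (Fin n) => balancedCoord y i := by
  refine Fin.lastCases ?_ (fun j => ?_) i
  · simp only [balancedCoord, Fin.lastCases_last]
    fun_prop
  · simp only [balancedCoord, Fin.lastCases_castSucc]
    fun_prop

lemma balancedCoord_combo (a b : ℝ) (y z : EuclideanSpace ℝ (Fin n)) (i : Fin (n + 1)) :
    balancedCoord (a • y + b • z) i = a * balancedCoord y i + b * balancedCoord z i := by
  refine Fin.lastCases ?_ (fun j => ?_) i
  · simp only [balancedCoord, Fin.lastCases_last]
    simp [Finset.sum_add_distrib, Finset.mul_sum]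
    ring
  · simp [balancedCoord, Fin.lastCases_castSucc]

lemma exists_balancedCoord_eq (c : Fin (n + 1) → ℝ) (hc : ∑ i, c i = 0) :
    ∃ y : EuclideanSpace ℝ (Fin n), ∀ i, balancedCoord y i = c i := by
  refine ⟨WithLp.toLp 2 fun j => c j.castSucc, fun i => ?_⟩
  rw [Fin.sum_univ_castSucc] at hc
  refine Fin.lastCases ?_ (fun j => ?_) i
  · simp only [balancedCoord, Fin.lastCases_last]
    linarith
  · simp [balancedCoord, Fin.lastCases_castSucc]

lemma eq_zero_of_balancedCoord_eq (y : EuclideanSpace ℝ (Fin n))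
    (h : ∀ i j, balancedCoord y i = balancedCoord y j) : y = 0 := by
  have h1 : ∀ i, balancedCoord y i = 0 := by
    intro i
    have h2 := sum_balancedCoord y
    rw [Finset.sum_congr rfl fun j _ => h j i, Finset.sum_const, Finset.card_univ,
      Fintype.card_fin, nsmul_eq_mul] at h2
    exact (mul_eq_zero.1 h2).resolve_left (by positivity)
  ext j
  have := h1 j.castSucc
  simpa [balancedCoord, Fin.lastCases_castSucc] using this

variable {X : Type*} [MetricSpace X] (e : X ≃ₜ EuclideanSpace ℝ (Fin n))

/-- The face spanned by `I` of the simplex of size `L` around the origin, transported to `X`. -/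
def simplexFace (L : ℝ) (I : Finset (Fin (n + 1))) : Set X :=
  {x | (∀ i, -L ≤ balancedCoord (e x) i) ∧ ∀ i ∉ I, balancedCoord (e x) i = -L}

lemma isCompact_simplexFace (L : ℝ) (I : Finset (Fin (n + 1))) :
    IsCompact (simplexFace e L I) := by
  have hcont : ∀ i, Continuous fun x => balancedCoord (e x) i := fun i =>
    (continuous_balancedCoord i).comp e.continuous
  have hclosed : IsClosed (simplexFace e L I) := by
    have : simplexFace e L I = (⋂ i, {x | -L ≤ balancedCoord (e x) i}) ∩
        ⋂ i, ⋂ (_ : i ∉ I), {x | balancedCoord (e x) i = -L} := by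
      ext x
      simp [simplexFace]
    rw [this]
    exact (isClosed_iInter fun i => isClosed_le continuous_const (hcont i)).inter
      (isClosed_iInter fun i => isClosed_iInter fun _ => isClosed_eq (hcont i) continuous_const)
  have hbox : IsCompact (Set.pi univ fun _ : Fin n => Icc (-L) (n * L)) :=
    isCompact_univ_pi fun _ => isCompact_Icc
  have hbox' : IsCompact (e.symm '' ((WithLp.toLp 2) ''
      (Set.pi univ fun _ : Fin n => Icc (-L) (n * L)))) :=
    (hbox.image (PiLp.continuous_toLp 2 _)).image e.symm.continuous
  refine hbox'.of_isClosed_subset hclosed fun x hx => ?_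
  refine ⟨e x, ⟨fun j => e x j, fun j _ => ?_, rfl⟩, by simp⟩
  have hj : balancedCoord (e x) j.castSucc = e x j := by
    simp [balancedCoord, Fin.lastCases_castSucc]
  refine ⟨(hx.1 j.castSucc).trans_eq hj, ?_⟩
  have hs := sum_balancedCoord (e x)
  rw [← Finset.add_sum_erase _ _ (Finset.mem_univ j.castSucc), hj] at hs
  have h1 : ∑ i ∈ Finset.univ.erase j.castSucc, -L
      ≤ ∑ i ∈ Finset.univ.erase j.castSucc, balancedCoord (e x) i :=
    Finset.sum_le_sum fun i _ => hx.1 i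
  rw [Finset.sum_const, Finset.card_erase_of_mem (Finset.mem_univ _), Finset.card_univ,
    Fintype.card_fin, nsmul_eq_mul] at h1
  simp only [Nat.add_sub_cancel] at h1
  show e x j ≤ _
  linarith

lemma simplexFace_mono (L : ℝ) {I J : Finset (Fin (n + 1))} (h : I ⊆ J) :
    simplexFace e L I ⊆ simplexFace e L J :=
  fun _ hx => ⟨hx.1, fun i hi => hx.2 i fun hi' => hi (h hi')⟩

/-- The affine contraction of `ℝⁿ` to a point, transported to `X`. -/
noncomputable def affineContraction (q : X) (p : ℝ × X) : X :=
  e.symm ((1 - p.1) • e p.2 + p.1 • e q)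

lemma continuous_affineContraction (q : X) : Continuous (affineContraction e q) := by
  unfold affineContraction
  have := e.continuous
  have := e.symm.continuous
  fun_prop

lemma affineContraction_zero (q x : X) : affineContraction e q (0, x) = x := by
  simp [affineContraction]

lemma affineContraction_one (q x : X) : affineContraction e q (1, x) = q := by
  simp [affineContraction]

open ListChain

/-- A large simplex in `ℝⁿ` can be subdivided into a fine chain, compatibly with its faces. -/
theorem exists_fine_subdivision {L : ℝ} (hL : 0 < L) {ε : ℝ} (hε : 0 < ε) :
    ∃ sd : FinsetChain (Fin (n + 1)) →ₗ[ZMod 2] ListChain X,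
      sd (Finsupp.single ∅ 1) = Finsupp.single [] 1 ∧
      ∀ I : Finset (Fin (n + 1)), sd (Finsupp.single I 1) ∈ fine I.card ε (simplexFace e L I) ∧
        boundary (sd (Finsupp.single I 1)) = sd (FinsetChain.boundary (Finsupp.single I 1)) := by
  have hfill : ∀ ε > 0, ∀ I : Finset (Fin (n + 1)), ∃ δ > 0, I.Nonempty → ∀ k : ℕ,
      ∀ z ∈ fine k δ (simplexFace e L I), boundary z = 0 →
        ∃ w ∈ fine (k + 1) ε (simplexFace e L I), boundary w = z := by
    intro ε hε I
    rcases I.eq_empty_or_nonempty with rfl | ⟨i₀, hi₀⟩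
    · exact ⟨1, one_pos, fun h => absurd h (by simp)⟩
    obtain ⟨y, hy⟩ := exists_balancedCoord_eq
      (fun i : Fin (n + 1) => -L + if i = i₀ then (n + 1) * L else 0) (by
        simp [Finset.sum_add_distrib])
    have hq : e.symm y ∈ simplexFace e L I := by
      refine ⟨fun i => ?_, fun i hi => ?_⟩
      · rw [e.apply_symm_apply, hy]
        split_ifs
        · have : (0 : ℝ) ≤ (n + 1) * L := by positivity
          linarith
        · simp
      · rw [e.apply_symm_apply, hy, if_neg (show i ≠ i₀ from fun h => hi (h.symm ▸ hi₀)), add_zero]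
    obtain ⟨δ, hδ, h⟩ := exists_filling_of_contraction (isCompact_simplexFace e L I)
      (continuous_affineContraction e (e.symm y)) hq (affineContraction_zero e _)
      (affineContraction_one e _) (S := simplexFace e L I) (by
        intro t ht x hx
        simp only [simplexFace, affineContraction, mem_ofPred_eq, e.apply_symm_apply,
          balancedCoord_combo] at hx hq ⊢
        refine ⟨fun i => ?_, fun i hi => ?_⟩
        · have h1 := mul_le_mul_of_nonneg_left (hx.1 i) (sub_nonneg.2 ht.2)
          have h2 := mul_le_mul_of_nonneg_left (hq.1 i) ht.1
          linarith
        · rw [hx.2 i hi, hq.2 i hi]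
          ring) hε
    exact ⟨δ, hδ, fun _ => h⟩
  obtain ⟨δ, hδ, H⟩ := exists_controlled_extension (X := X) (ι := Finset (Fin (n + 1)))
    Finset.card 0 FinsetChain.boundary FinsetChain.boundary_boundary univ
    (simplexFace e L) (simplexFace e L) (by
      intro k ε hε
      choose δ hδ h using hfill ε hε
      refine ⟨Finset.univ.inf' ⟨∅, Finset.mem_univ _⟩ δ,
        (Finset.lt_inf'_iff _).2 fun I _ => hδ I, fun I _ hI z hz hbz => ?_⟩
      exact h I (Finset.card_pos.1 (by omega)) k z
        (fine_mono (Finset.inf'_le _ (Finset.mem_univ _)) subset_rfl hz) hbz) (n + 1) ε hε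
  obtain ⟨sd, h0, hsd⟩ := H univ subset_rfl (by
    intro I _ k hk
    rw [FinsetChain.boundary_single]
    refine sum_mem fun i hi => Finsupp.single_mem_supported _ _ ⟨mem_univ _, ?_, ?_⟩
    · rw [Finset.card_erase_of_mem hi]
      omega
    · exact simplexFace_mono e L (Finset.erase_subset _ _)) 0 (by simp)
    (fun _ _ _ _ _ => zero_mem _) (fun _ => Finsupp.single [] 1) (by
      intro I _ hI
      rw [Finset.card_eq_zero] at hI
      subst hI
      refine ⟨by simp [FinsetChain.boundary_single], fun η _ => ?_, by simp⟩
      exact single_mem_fine rfl (by simp) (by simp) _)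
  refine ⟨sd, h0 ∅ (mem_univ _) rfl, fun I => ?_⟩
  simpa using hsd I (mem_univ _) (by simpa using Finset.card_le_univ I)

/-- There is a labelling of `X` by the `n + 1` coordinates such that labels of points in a face
around the origin belong to that face, and such that fine simplices away from the origin do not
have all the labels. The label of a point is the index of one of its largest coordinates. -/
theorem exists_labelling : ∃ lab : X → Fin (n + 1),
    (∀ L > 0, ∀ I, ∀ x ∈ simplexFace e L I, lab x ∈ I) ∧
    ∀ Z : Set X, IsCompact Z → e.symm 0 ∉ Z → ∃ ε > 0, ∀ k, ∀ c ∈ fine k ε Z,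
      FinsetChain.ofList (push lab c) Finset.univ = 0 := by
  choose lab hlab using fun x : X => Finite.exists_max (balancedCoord (e x))
  refine ⟨lab, fun L hL I x hx => ?_, fun Z hZ h0 => ?_⟩
  · by_contra h
    -- otherwise the largest coordinate is negative, while the sum of the coordinates is zero
    have h1 : ∑ i, balancedCoord (e x) i ≤ ∑ i : Fin (n + 1), -L :=
      Finset.sum_le_sum fun i _ => (hlab x i).trans_eq (hx.2 _ h)
    rw [sum_balancedCoord, Finset.sum_const, Finset.card_univ, Fintype.card_fin,
      nsmul_eq_mul] at h1
    have : (0 : ℝ) < ((n + 1 : ℕ) : ℝ) * L := by positivity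
    linarith
  · have hcont : ∀ i, Continuous fun x => balancedCoord (e x) i := fun i =>
      (continuous_balancedCoord i).comp e.continuous
    obtain ⟨δ, hδ, h⟩ := lebesgue_number_lemma_of_metric hZ
      (c := fun i => {x | balancedCoord (e x) i < balancedCoord (e x) (lab x)}) (by
        intro i
        have : {x | balancedCoord (e x) i < balancedCoord (e x) (lab x)}
            = ⋃ j, {x | balancedCoord (e x) i < balancedCoord (e x) j} := by
          ext x
          simp only [mem_ofPred_eq, mem_iUnion]
          exact ⟨fun h => ⟨_, h⟩, fun ⟨j, hj⟩ => hj.trans_le (hlab x j)⟩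
        rw [this]
        exact isOpen_iUnion fun j => isOpen_lt (hcont i) (hcont j)) (by
        intro x hx
        by_contra hx'
        simp only [mem_iUnion, mem_ofPred_eq, not_exists, not_lt] at hx'
        apply h0
        have : e x = 0 := eq_zero_of_balancedCoord_eq _ fun i j =>
          ((hlab x i).antisymm (hx' i)).trans ((hlab x j).antisymm (hx' j)).symm
        rw [← this, e.symm_apply_apply]
        exact hx)
    refine ⟨δ / 2, by positivity, fun k c hc => ?_⟩
    have : (Finsupp.lapply Finset.univ ∘ₗ FinsetChain.ofList ∘ₗ push lab) c
        ∈ (⊥ : Submodule (ZMod 2) (ZMod 2)) := by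
      refine map_mem_of_mem_fine hc _ _ fun l _ hl hl' => ?_
      simp only [LinearMap.comp_apply, push_single, FinsetChain.ofList_single, Submodule.mem_bot]
      split_ifs
      · rw [Finsupp.lapply_apply, Finsupp.single_apply, if_neg]
        intro hu
        have hall : ∀ i, ∃ x ∈ l, lab x = i := by
          intro i
          have : i ∈ (l.map lab).toFinset := hu ▸ Finset.mem_univ i
          simpa using this
        obtain ⟨x, hx, -⟩ := hall 0
        obtain ⟨i, hi⟩ := h x (hl x hx)
        obtain ⟨y, hy, hyi⟩ := hall i
        have hyx : y ∈ Metric.ball x δ :=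
          (hl' y hy x hx).trans_lt (half_lt_self hδ)
        have := hi hyx
        rw [mem_ofPred_eq, hyi] at this
        exact lt_irrefl _ this
      · simp
    simpa using this

end Coordinates

/-! ### Uniform acyclicity and controlled chain maps -/

namespace ListChain

variable {X : Type*} [MetricSpace X]

/-- `X` is uniformly acyclic with control function `φ`: fine cycles in a ball of radius `r` bound
fine chains in the concentric ball of radius `φ r`, where the fineness needed for the cycle depends
on `r` and on the fineness wanted for the filling, but not on the centre of the ball. -/
def UniformlyAcyclic (X : Type*) [MetricSpace X] (φ : ℝ → ℝ) : Prop :=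
  ∀ r : ℝ, ∀ ε > 0, ∃ δ > 0, ∀ (a : X) (k : ℕ), ∀ z ∈ fine k δ (Metric.closedBall a r),
    boundary z = 0 → ∃ w ∈ fine (k + 1) ε (Metric.closedBall a (φ r)), boundary w = z

/-- A proper metric space homeomorphic to `ℝⁿ` with cocompact isometry group is uniformly acyclic:
isometries bring a ball near a fixed compact set, where a contraction has uniform control. -/
theorem exists_uniformlyAcyclic {n : ℕ} [ProperSpace X] (e : X ≃ₜ EuclideanSpace ℝ (Fin n))
    {K : Set X} (hK : IsCompact K) (hcov : ∀ x, ∃ g : X ≃ᵢ X, g x ∈ K) :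
    ∃ φ, UniformlyAcyclic X φ := by
  let q : X := e.symm 0
  obtain ⟨d, hd⟩ : ∃ d, K ⊆ Metric.closedBall q d := hK.isBounded.subset_closedBall q
  have hball : ∀ r, ∃ ρ, dist q q ≤ ρ ∧ ∀ t ∈ Icc (0 : ℝ) 1, ∀ x ∈ Metric.closedBall q (d + r),
      affineContraction e q (t, x) ∈ Metric.closedBall q ρ := by
    intro r
    have hc : IsCompact (affineContraction e q '' (Icc (0 : ℝ) 1 ×ˢ Metric.closedBall q (d + r))) :=
      (isCompact_Icc.prod (isCompact_closedBall _ _)).image (continuous_affineContraction e q)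
    obtain ⟨ρ, hρ⟩ := hc.isBounded.subset_closedBall q
    refine ⟨max ρ 0, by simp, fun t ht x hx => ?_⟩
    exact Metric.closedBall_subset_closedBall (le_max_left _ _) (hρ ⟨(t, x), ⟨ht, hx⟩, rfl⟩)
  choose ρ hρ0 hρ using hball
  refine ⟨fun r => ρ r + d, fun r ε hε => ?_⟩
  obtain ⟨δ, hδ, H⟩ := exists_filling_of_contraction (isCompact_closedBall q (d + r))
    (continuous_affineContraction e q) (q := q) (S := Metric.closedBall q (ρ r)) (hρ0 r)
    (affineContraction_zero e q) (affineContraction_one e q) (hρ r) hε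
  refine ⟨δ, hδ, fun a k z hz hbz => ?_⟩
  obtain ⟨g, hg⟩ := hcov a
  have hga : dist (g a) q ≤ d := hd hg
  obtain ⟨w, hw, hbw⟩ := H k (push g z) (push_mem_fine hz (fun x hx => by
      rw [Metric.mem_closedBall] at hx ⊢
      have h1 : dist (g x) (g a) ≤ r := by rwa [g.dist_eq]
      linarith [dist_triangle (g x) (g a) q]) fun x _ y _ h => by rwa [g.dist_eq])
    (by rw [boundary_push, hbz, map_zero])
  refine ⟨push g.symm w, push_mem_fine hw (fun x hx => ?_) (fun x _ y _ h => by
    rwa [g.symm.dist_eq]), ?_⟩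
  · rw [Metric.mem_closedBall] at hx ⊢
    have h1 : dist (g.symm x) a = dist x (g a) := by
      rw [← g.dist_eq, g.apply_symm_apply]
    rw [h1]
    linarith [dist_triangle x q (g a), dist_comm q (g a)]
  · rw [boundary_push, hbw, push_push]
    have : (g.symm : X → X) ∘ g = id := by
      funext x
      simp
    rw [this, push_id]

/-- Controlled realization of the unordered simplices of bounded diameter by fine chains, for which
the faces are respected. -/
theorem UniformlyAcyclic.exists_realization [DecidableEq X] {φ : ℝ → ℝ} (hφ : UniformlyAcyclic X φ)
    (r : ℝ) : ∃ ρ : ℕ → ℝ, ∀ N : ℕ, ∀ ε > 0, ∃ ψ : FinsetChain X →ₗ[ZMod 2] ListChain X,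
      ψ (Finsupp.single ∅ 1) = Finsupp.single [] 1 ∧
      ∀ s : Finset X, (∀ x ∈ s, ∀ y ∈ s, dist x y ≤ r) → s.card ≤ N →
        ψ (Finsupp.single s 1) ∈ fine s.card ε {x | ∃ a ∈ s, dist x a ≤ ρ s.card} ∧
        boundary (ψ (Finsupp.single s 1)) = ψ (FinsetChain.boundary (Finsupp.single s 1)) := by
  let ρ : ℕ → ℝ := fun k => Nat.rec 0 (fun _ t => φ (t + r)) k
  have hρ : ∀ k, ρ (k + 1) = φ (ρ k + r) := fun _ => rfl
  refine ⟨ρ, fun N ε hε => ?_⟩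
  obtain ⟨δ, hδ, H⟩ := exists_controlled_extension (X := X) (ι := Finset X)
    Finset.card 0 FinsetChain.boundary FinsetChain.boundary_boundary
    {s | ∀ x ∈ s, ∀ y ∈ s, dist x y ≤ r}
    (fun s => {x | ∃ a ∈ s, dist x a ≤ ρ s.card})
    (fun s => {x | ∃ a ∈ s, dist x a ≤ ρ (s.card - 1)}) (by
      intro k ε hε
      obtain ⟨δ, hδ, h⟩ := hφ (ρ k + r) ε hε
      refine ⟨δ, hδ, fun s hs hsk z hz hbz => ?_⟩
      obtain ⟨a, ha⟩ : s.Nonempty := Finset.card_pos.1 (by omega)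
      obtain ⟨w, hw, hbw⟩ := h a k z (fine_mono le_rfl (by
        rintro x ⟨b, hb, hx⟩
        rw [hsk, Nat.add_sub_cancel] at hx
        rw [Metric.mem_closedBall]
        linarith [dist_triangle x b a, hs b hb a ha]) hz) hbz
      have hsub : Metric.closedBall a (φ (ρ k + r)) ⊆ {x | ∃ a ∈ s, dist x a ≤ ρ s.card} := by
        rw [hsk, hρ]
        exact fun x hx => ⟨a, ha, hx⟩
      exact ⟨w, fine_mono le_rfl hsub hw, hbw⟩) N ε hε
  obtain ⟨ψ, h0, hψ⟩ := H _ subset_rfl (by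
    intro s hs k hk
    rw [FinsetChain.boundary_single]
    refine sum_mem fun i hi => Finsupp.single_mem_supported _ _ ⟨?_, ?_, ?_⟩
    · exact fun x hx y hy => hs x (Finset.mem_of_mem_erase hx) y (Finset.mem_of_mem_erase hy)
    · rw [Finset.card_erase_of_mem hi]
      omega
    · rintro x ⟨a, ha, hx⟩
      rw [Finset.card_erase_of_mem hi] at hx
      exact ⟨a, Finset.mem_of_mem_erase ha, hx⟩) 0 (by simp)
    (fun _ _ _ _ _ => zero_mem _) (fun _ => Finsupp.single [] 1) (by
      intro s _ hs
      rw [Finset.card_eq_zero] at hs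
      subst hs
      refine ⟨by simp [FinsetChain.boundary_single], fun η _ => ?_, by simp⟩
      exact single_mem_fine rfl (by simp) (by simp) _)
  refine ⟨ψ, h0 ∅ (by simp) rfl, fun s hs hsN => ?_⟩
  simpa using hψ s hs hsN

/-- If `f` moves points a bounded amount, then the composition of `f` with a realization `ψ` of the
simplices of bounded diameter is homotopic to the identity on fine chains, in a controlled way. -/
theorem UniformlyAcyclic.exists_homotopy [DecidableEq X] {φ : ℝ → ℝ} (hφ : UniformlyAcyclic X φ)
    (R₀ : ℝ) (ρ : ℕ → ℝ) : ∃ ρ' : ℕ → ℝ, ∀ N : ℕ, ∀ ε > 0, ∃ δ > 0, δ ≤ 1 ∧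
      ∀ f : X → X, (∀ x, dist (f x) x ≤ R₀) →
      ∀ ψ : FinsetChain X →ₗ[ZMod 2] ListChain X,
      ψ (Finsupp.single ∅ 1) = Finsupp.single [] 1 →
      (∀ s : Finset X, (∀ x ∈ s, ∀ y ∈ s, dist x y ≤ 2 * R₀ + 1) → s.card ≤ N →
        ψ (Finsupp.single s 1) ∈ fine s.card δ {x | ∃ a ∈ s, dist x a ≤ ρ s.card} ∧
        boundary (ψ (Finsupp.single s 1)) = ψ (FinsetChain.boundary (Finsupp.single s 1))) →
      ∃ Γ : ListChain X →ₗ[ZMod 2] ListChain X,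
        ∀ l : List X, (∀ x ∈ l, ∀ y ∈ l, dist x y ≤ δ) → l.length ≤ N →
          Γ (Finsupp.single l 1) ∈ fine (l.length + 1) ε {x | ∃ a ∈ l, dist x a ≤ ρ' l.length} ∧
          boundary (Γ (Finsupp.single l 1)) = Γ (boundary (Finsupp.single l 1)) +
            (ψ (FinsetChain.ofList (push f (Finsupp.single l 1))) + Finsupp.single l 1) := by
  -- the radius of the cycles which have to be filled for lists with `k + 1` entries
  let σ : ℕ → ℝ → ℝ := fun k t => max t (max 0 (ρ (k + 1) + R₀))
  let ρ' : ℕ → ℝ := fun k => Nat.rec 0 (fun k t => φ (σ k t + 1)) k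
  have hρ' : ∀ k, ρ' (k + 1) = φ (σ k (ρ' k) + 1) := fun _ => rfl
  refine ⟨ρ', fun N ε hε => ?_⟩
  obtain ⟨δ, hδ, H⟩ := exists_controlled_extension (X := X) (ι := List X)
    List.length 1 boundary boundary_boundary
    {l | ∀ x ∈ l, ∀ y ∈ l, dist x y ≤ 1}
    (fun l => {x | ∃ a ∈ l, dist x a ≤ ρ' l.length})
    (fun l => {x | ∃ a ∈ l, dist x a ≤ σ (l.length - 1) (ρ' (l.length - 1))}) (by
      intro k ε hε
      obtain ⟨δ, hδ, h⟩ := hφ (σ k (ρ' k) + 1) ε hε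
      refine ⟨δ, hδ, fun l hl hlk z hz hbz => ?_⟩
      obtain ⟨a, ha⟩ : ∃ a, a ∈ l := List.exists_mem_of_length_pos (by omega)
      obtain ⟨w, hw, hbw⟩ := h a (k + 1) z (fine_mono le_rfl (by
        rintro x ⟨b, hb, hx⟩
        rw [hlk, Nat.add_sub_cancel] at hx
        rw [Metric.mem_closedBall]
        linarith [dist_triangle x b a, hl b hb a ha]) hz) hbz
      have hsub : Metric.closedBall a (φ (σ k (ρ' k) + 1)) ⊆
          {x | ∃ a ∈ l, dist x a ≤ ρ' l.length} := by
        rw [hlk, hρ']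
        exact fun x hx => ⟨a, ha, hx⟩
      exact ⟨w, fine_mono le_rfl hsub hw, hbw⟩) N ε hε
  refine ⟨min δ 1, lt_min hδ one_pos, min_le_right _ _, fun f hf ψ hψ0 hψ => ?_⟩
  have hlab : ∀ l : List X, (∀ x ∈ l, ∀ y ∈ l, dist x y ≤ min δ 1) →
      ∀ x ∈ (l.map f).toFinset, ∀ y ∈ (l.map f).toFinset, dist x y ≤ 2 * R₀ + 1 := by
    intro l hl x hx y hy
    simp only [List.mem_toFinset, List.mem_map] at hx hy
    obtain ⟨a, ha, rfl⟩ := hx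
    obtain ⟨b, hb, rfl⟩ := hy
    have h1 := dist_triangle4 (f a) a b (f b)
    have h2 := hf b
    rw [dist_comm] at h2
    linarith [hf a, (hl a ha b hb).trans (min_le_right _ _)]
  obtain ⟨Γ, -, hΓ⟩ := H {l | ∀ x ∈ l, ∀ y ∈ l, dist x y ≤ min δ 1}
    (fun l hl x hx y hy => (hl x hx y hy).trans (min_le_right _ _)) (by
      intro l hl k hk
      rw [boundary_single]
      refine Finsupp.supported_mono ?_ (listBoundary_mem l)
      rintro l' ⟨h1, h2⟩
      have h3 : l'.length = k := by omega
      refine ⟨fun x hx y hy => hl x (h2 x hx) y (h2 y hy), h3, ?_⟩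
      rintro x ⟨a, ha, hx⟩
      refine ⟨a, h2 a ha, hx.trans ?_⟩
      rw [hk, h3, Nat.add_sub_cancel]
      exact le_max_left _ _)
    (ψ ∘ₗ FinsetChain.ofList ∘ₗ push f + LinearMap.id) (by
      intro l hl hlN
      simp only [LinearMap.add_apply, LinearMap.comp_apply, LinearMap.id_apply, map_add]
      congr 1
      rw [← boundary_push, ← FinsetChain.boundary_ofList, push_single, FinsetChain.ofList_single]
      split_ifs with hnd
      · refine (hψ _ (hlab l hl) ?_).2
        rwa [List.toFinset_card_of_nodup hnd, List.length_map]
      · simp) (by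
      intro l hl k hkN hk
      simp only [LinearMap.add_apply, LinearMap.comp_apply, LinearMap.id_apply, push_single,
        FinsetChain.ofList_single]
      have hself : ∀ x ∈ l, x ∈ {x | ∃ a ∈ l, dist x a ≤ σ (l.length - 1) (ρ' (l.length - 1))} :=
        fun x hx => ⟨x, hx, by
          rw [dist_self]
          exact (le_max_left _ _).trans (le_max_right _ _)⟩
      refine add_mem ?_ (single_mem_fine hk hself
        (fun x hx y hy => (hl x hx y hy).trans (min_le_left _ _)) _)
      · split_ifs with hnd
        · have hcard : (l.map f).toFinset.card = k + 1 := by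
            rw [List.toFinset_card_of_nodup hnd, List.length_map, hk]
          have := (hψ _ (hlab l hl) (by omega)).1
          rw [hcard] at this
          refine fine_mono (min_le_left _ _) ?_ this
          rintro x ⟨b, hb, hx⟩
          simp only [List.mem_toFinset, List.mem_map] at hb
          obtain ⟨a, ha, rfl⟩ := hb
          refine ⟨a, ha, ?_⟩
          rw [hk, Nat.add_sub_cancel]
          refine le_trans ?_ ((le_max_right _ _).trans (le_max_right _ _))
          linarith [dist_triangle x (f a) a, hf a]
        · rw [map_zero]
          exact zero_mem _) (fun _ => 0) (by
      intro l _ hl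
      rw [List.length_eq_zero_iff] at hl
      subst hl
      refine ⟨by simp, fun η _ => zero_mem _, ?_⟩
      simp [FinsetChain.ofList_single, hψ0, ZModModule.add_self])
  refine ⟨Γ, fun l hl hlN => ?_⟩
  simpa using hΓ l hl hlN

end ListChain

/-! ### The covering theorem -/

open ListChain in
/-- A proper metric space homeomorphic to `ℝⁿ` with cocompact isometry group cannot be coloured
with `m + 1 ≤ n` colours in such a way that, at small scale, points of the same colour have the
same label, where the labels are points at bounded distance. -/
theorem not_exists_bounded_colouring {n m : ℕ} (hmn : m < n) {X : Type*} [MetricSpace X]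
    [ProperSpace X] (e : X ≃ₜ EuclideanSpace ℝ (Fin n))
    {K : Set X} (hK : IsCompact K) (hcov : ∀ x, ∃ g : X ≃ᵢ X, g x ∈ K)
    (R₀ : ℝ) (hf : ∀ S : Set X, IsCompact S → ∃ δ > 0, ∃ f : X → X, ∃ colour : X → Fin (m + 1),
      (∀ x, dist (f x) x ≤ R₀) ∧
      ∀ x ∈ S, ∀ y ∈ S, dist x y ≤ δ → colour x = colour y → f x = f y) : False := by
  classical
  obtain ⟨φ, hφ⟩ := exists_uniformlyAcyclic e hK hcov
  obtain ⟨ρ, hρ⟩ := hφ.exists_realization (2 * R₀ + 1)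
  obtain ⟨ρ', hρ'⟩ := hφ.exists_homotopy R₀ ρ
  let o : X := e.symm 0
  -- chains supported outside the ball of radius `D` stay away from the origin when pushed
  let D : ℝ := 2 + |R₀| + |ρ (n + 1)| + |ρ' n|
  obtain ⟨L, hL, hLD⟩ : ∃ L > 0, ∀ x ∈ Metric.closedBall o D, ∀ i,
      -L < balancedCoord (e x) i := by
    have : ∀ i : Fin (n + 1), ∃ L, ∀ x ∈ Metric.closedBall o D, L ≤ balancedCoord (e x) i := by
      intro i
      obtain ⟨L, hL⟩ := ((isCompact_closedBall o D).image
        ((continuous_balancedCoord i).comp e.continuous)).bddBelow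
      exact ⟨L, fun x hx => hL ⟨x, hx, rfl⟩⟩
    choose L hL using this
    refine ⟨1 + ∑ i, |L i|, by positivity, fun x hx i => ?_⟩
    have h1 : |L i| ≤ ∑ i, |L i| :=
      Finset.single_le_sum (f := fun i => |L i|) (fun i _ => abs_nonneg _) (Finset.mem_univ i)
    linarith [hL i x hx, neg_abs_le (L i)]
  obtain ⟨D', hD'⟩ := (isCompact_simplexFace e L Finset.univ).isBounded.subset_closedBall o
  let Z : Set X := Metric.closedBall o (D' + D) \ Metric.ball o 1
  have hZ : IsCompact Z := (isCompact_closedBall _ _).diff Metric.isOpen_ball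
  obtain ⟨lab, hlab, hlabZ⟩ := exists_labelling e
  obtain ⟨ε, hε, hrain⟩ := hlabZ Z hZ (fun h => h.2 (Metric.mem_ball_self one_pos))
  obtain ⟨δΓ, hδΓ, hδΓ1, hΓ⟩ := hρ' (n + 1) ε hε
  obtain ⟨δf, hδf, f, colour, hfR, hfc⟩ := hf (Metric.closedBall o D) (isCompact_closedBall _ _)
  obtain ⟨ψ, hψ0, hψ⟩ := hρ (n + 1) (min ε δΓ) (lt_min hε hδΓ)
  obtain ⟨Γ, hΓ⟩ := hΓ f hfR ψ hψ0 fun s hs hsN =>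
    ⟨fine_mono (min_le_right _ _) subset_rfl (hψ s hs hsN).1, (hψ s hs hsN).2⟩
  obtain ⟨sd, hsd0, hsd⟩ := exists_fine_subdivision (n := n) e hL (lt_min hδΓ hδf)
  -- the number modulo two of simplices having all the labels
  let χ : ListChain X →ₗ[ZMod 2] ZMod 2 :=
    Finsupp.lapply Finset.univ ∘ₗ FinsetChain.ofList ∘ₗ push lab
  have hχ : ∀ c, χ c = FinsetChain.ofList (push lab c) Finset.univ := fun c => rfl
  set b : ListChain X := sd (Finsupp.single Finset.univ 1) with hb
  have hcardu : (Finset.univ : Finset (Fin (n + 1))).card = n + 1 := by simp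
  have hbf : b ∈ fine (n + 1) (min δΓ δf) (simplexFace e L Finset.univ) := by
    have := (hsd Finset.univ).1
    rwa [hcardu] at this
  -- Sperner's lemma
  have hχb : χ b = 1 := by
    rw [hχ, hb, ofList_push_of_labels_mem lab sd hsd0 ?_ fun I => (hsd I).2]
    · simp
    · intro I
      refine Finsupp.supported_mono ?_ (hsd I).1
      exact fun l hl => ⟨hl.1, fun x hx => hlab L hL I x (hl.2.1 x hx)⟩
  -- simplices near the origin have two vertices with the same colour, the others stay away from it
  have hχψ : χ (ψ (FinsetChain.ofList (push f b))) = 0 := by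
    have : (χ ∘ₗ ψ ∘ₗ FinsetChain.ofList ∘ₗ push f) b ∈ (⊥ : Submodule (ZMod 2) (ZMod 2)) := by
      refine map_mem_of_mem_fine hbf _ _ fun l hln hlF hlδ => ?_
      simp only [LinearMap.comp_apply, push_single, FinsetChain.ofList_single, Submodule.mem_bot]
      split_ifs with hnd
      swap
      · simp
      have hdist : ∀ x ∈ l, ∀ y ∈ l, dist x y ≤ 1 := fun x hx y hy =>
        (hlδ x hx y hy).trans ((min_le_left _ _).trans hδΓ1)
      have hcard : (l.map f).toFinset.card = n + 1 := by
        rw [List.toFinset_card_of_nodup hnd, List.length_map, hln]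
      have hfin := (hψ (l.map f).toFinset (by
        intro x hx y hy
        simp only [List.mem_toFinset, List.mem_map] at hx hy
        obtain ⟨a, ha, rfl⟩ := hx
        obtain ⟨c, hc, rfl⟩ := hy
        have h1 := dist_triangle4 (f a) a c (f c)
        have h2 := hfR c
        rw [dist_comm] at h2
        linarith [hfR a, hdist a ha c hc]) hcard.le).1
      rw [hcard] at hfin
      by_cases hnear : ∀ x ∈ l, x ∈ Metric.closedBall o D
      · exfalso
        have hfinj : ∀ x ∈ l.toFinset, ∀ y ∈ l.toFinset, colour x = colour y → x = y := by
          intro x hx y hy hxy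
          rw [List.mem_toFinset] at hx hy
          exact List.inj_on_of_nodup_map hnd hx hy
            (hfc x (hnear x hx) y (hnear y hy) ((hlδ x hx y hy).trans (min_le_right _ _)) hxy)
        have h1 : l.toFinset.card ≤ (Finset.univ : Finset (Fin (m + 1))).card :=
          Finset.card_le_card_of_injOn colour (fun _ _ => Finset.mem_univ _) hfinj
        rw [List.toFinset_card_of_nodup (List.Nodup.of_map f hnd), hln] at h1
        simp at h1
        omega
      · push Not at hnear
        obtain ⟨a, ha, haD⟩ := hnear
        rw [Metric.mem_closedBall, not_le] at haD
        refine hrain (n + 1) _ (fine_mono (min_le_left _ _) ?_ hfin)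
        rintro x ⟨c, hc, hx⟩
        simp only [List.mem_toFinset, List.mem_map] at hc
        obtain ⟨c, hc, rfl⟩ := hc
        have hxc : dist x c ≤ |ρ (n + 1)| + |R₀| := by
          linarith [dist_triangle x (f c) c, hfR c, le_abs_self (ρ (n + 1)), le_abs_self R₀]
        have hcD' : dist c o ≤ D' := hD' (hlF c hc)
        have h0 := abs_nonneg (ρ' n)
        refine ⟨?_, ?_⟩
        · rw [Metric.mem_closedBall]
          linarith [dist_triangle x c o]
        · rw [Metric.mem_ball, not_lt]
          have := dist_triangle4 a c x o
          linarith [hdist a ha c hc, dist_comm x c]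
    exact this
  -- the homotopy stays away from the origin on the boundary
  have hχΓ : χ (Γ (boundary b)) = 0 := by
    rw [hb, (hsd Finset.univ).2, FinsetChain.boundary_single]
    simp only [map_sum]
    refine Finset.sum_eq_zero fun i hi => ?_
    have hcard : (Finset.univ.erase i).card = n := by
      rw [Finset.card_erase_of_mem hi, hcardu, Nat.add_sub_cancel]
    have hI := (hsd (Finset.univ.erase i)).1
    rw [hcard] at hI
    have : (χ ∘ₗ Γ) (sd (Finsupp.single (Finset.univ.erase i) 1)) ∈
        (⊥ : Submodule (ZMod 2) (ZMod 2)) := by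
      refine map_mem_of_mem_fine hI _ _ fun l hln hlF hlδ => ?_
      have hfin := (hΓ l (fun x hx y hy => (hlδ x hx y hy).trans (min_le_left _ _))
        (by omega)).1
      rw [hln] at hfin
      refine hrain (n + 1) _ (fine_mono le_rfl ?_ hfin)
      rintro x ⟨a, ha, hx⟩
      have hxa : dist x a ≤ |ρ' n| := hx.trans (le_abs_self _)
      have haD' : dist a o ≤ D' :=
        hD' (simplexFace_mono e L (Finset.erase_subset _ _) (hlF a ha))
      have haD : D < dist a o := by
        by_contra h
        have h1 := hLD a (not_lt.1 h) i
        have h2 := (hlF a ha).2 i (by simp)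
        linarith
      have h0 := abs_nonneg (ρ (n + 1))
      have h0' := abs_nonneg R₀
      refine ⟨?_, ?_⟩
      · rw [Metric.mem_closedBall]
        linarith [dist_triangle x a o]
      · rw [Metric.mem_ball, not_lt]
        have := dist_triangle a x o
        linarith [dist_comm x a]
    exact this
  -- no chain with `n + 2` vertices per simplex has a boundary with an odd number of them
  have hχbd : χ (boundary (Γ b)) = 0 := by
    rw [hχ, ← boundary_push, ← FinsetChain.boundary_ofList]
    have : (FinsetChain.ofList ∘ₗ push lab ∘ₗ Γ) b ∈
        (⊥ : Submodule (ZMod 2) (FinsetChain (Fin (n + 1)))) := by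
      refine map_mem_of_mem_fine hbf _ _ fun l hln hlF hlδ => ?_
      have hfin := (hΓ l (fun x hx y hy => (hlδ x hx y hy).trans (min_le_left _ _)) hln.le).1
      have : (FinsetChain.ofList ∘ₗ push lab) (Γ (Finsupp.single l 1)) ∈
          (⊥ : Submodule (ZMod 2) (FinsetChain (Fin (n + 1)))) := by
        refine map_mem_of_mem_fine hfin _ _ fun l' hl' _ _ => ?_
        simp only [LinearMap.comp_apply, push_single, FinsetChain.ofList_single,
          Submodule.mem_bot]
        rw [if_neg]
        intro hnd
        have := hnd.length_le_card
        simp at this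
        omega
      exact this
    rw [Submodule.mem_bot] at this
    simp only [LinearMap.comp_apply] at this
    rw [this]
    simp
  have hhom : boundary (Γ b) = Γ (boundary b) + (ψ (FinsetChain.ofList (push f b)) + b) := by
    let T : ListChain X →ₗ[ZMod 2] ListChain X :=
      Γ ∘ₗ boundary + (ψ ∘ₗ FinsetChain.ofList ∘ₗ push f + LinearMap.id)
    have : (boundary ∘ₗ Γ + T) b ∈ (⊥ : Submodule (ZMod 2) (ListChain X)) := by
      refine map_mem_of_mem_fine hbf _ _ fun l hln hlF hlδ => ?_
      simp only [T, LinearMap.add_apply, LinearMap.comp_apply, LinearMap.id_apply,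
        Submodule.mem_bot]
      rw [(hΓ l (fun x hx y hy => (hlδ x hx y hy).trans (min_le_left _ _)) hln.le).2,
        ZModModule.add_self]
    rw [Submodule.mem_bot, LinearMap.add_apply, ← ZModModule.sub_eq_add, sub_eq_zero] at this
    exact this
  have := congrArg χ hhom
  rw [map_add, map_add, hχbd, hχΓ, hχψ, hχb] at this
  simp at this

/-! ### Labels of lifted pieces -/

section Labels

variable {X : Type*} [MetricSpace X]

/-- A bounded component of a closed subset `F` of a proper metric space is contained in a bounded
set which is relatively closed and open in `F`. -/
theorem exists_bounded_clopen_of_isBounded_component [ProperSpace X] {F : Set X}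
    (hF : IsClosed F) {x : X} (hx : x ∈ F) (hb : Bornology.IsBounded (connectedComponentIn F x)) :
    ∃ V ⊆ F, x ∈ V ∧ Bornology.IsBounded V ∧ IsClosed V ∧ IsClosed (F \ V) := by
  obtain ⟨r, hr⟩ := hb.subset_closedBall x
  have hr0 : 0 ≤ r := by
    simpa using hr (mem_connectedComponentIn hx)
  -- intersect `F` with a ball which contains the component in its interior
  let F' : Set X := F ∩ Metric.closedBall x (r + 1)
  have hF' : IsCompact F' := (isCompact_closedBall x (r + 1)).inter_left hF
  have hxF' : x ∈ F' := ⟨hx, Metric.mem_closedBall_self (by linarith)⟩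
  have : CompactSpace F' := isCompact_iff_compactSpace.1 hF'
  let U : Set F' := {y | dist (y : X) x < r + 1}
  have hU : IsOpen U := isOpen_lt (by fun_prop) continuous_const
  have hcomp : connectedComponent (⟨x, hxF'⟩ : F') ⊆ U := by
    intro y hy
    have h1 : (Subtype.val '' connectedComponent (⟨x, hxF'⟩ : F')) ⊆ connectedComponentIn F x := by
      apply IsPreconnected.subset_connectedComponentIn
      · exact isPreconnected_connectedComponent.image _ continuous_subtype_val.continuousOn
      · exact ⟨⟨x, hxF'⟩, mem_connectedComponent, rfl⟩
      · rintro _ ⟨z, -, rfl⟩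
        exact z.2.1
    have h2 := hr (h1 ⟨y, hy, rfl⟩)
    rw [Metric.mem_closedBall] at h2
    show dist (y : X) x < r + 1
    linarith
  obtain ⟨Z, hZ, hxZ, hZU⟩ : ∃ Z : Set F', IsClopen Z ∧ ⟨x, hxF'⟩ ∈ Z ∧ Z ⊆ U := by
    rw [connectedComponent_eq_iInter_isClopen] at hcomp
    have : Nonempty { s : Set F' // IsClopen s ∧ (⟨x, hxF'⟩ : F') ∈ s } :=
      ⟨⟨univ, isClopen_univ, mem_univ _⟩⟩
    obtain ⟨Z, hZ⟩ := exists_subset_nhds_of_compactSpace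
      (V := fun s : { s : Set F' // IsClopen s ∧ (⟨x, hxF'⟩ : F') ∈ s } => (s : Set F'))
      (fun a b => ⟨⟨a ∩ b, a.2.1.inter b.2.1, a.2.2, b.2.2⟩, inter_subset_left, inter_subset_right⟩)
      (fun s => s.2.1.1) (fun y hy => hU.mem_nhds (hcomp hy))
    exact ⟨Z, Z.2.1, Z.2.2, hZ⟩
  refine ⟨Subtype.val '' Z, ?_, ⟨_, hxZ, rfl⟩, ?_, ?_, ?_⟩
  · rintro _ ⟨z, -, rfl⟩
    exact z.2.1
  · refine Metric.isBounded_closedBall.subset (?_ : _ ⊆ Metric.closedBall x (r + 1))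
    rintro _ ⟨z, -, rfl⟩
    exact z.2.2
  · exact (hZ.1.isCompact.image continuous_subtype_val).isClosed
  · have : F \ Subtype.val '' Z = Subtype.val '' Zᶜ ∪ F ∩ {y | r + 1 ≤ dist y x} := by
      ext y
      constructor
      · rintro ⟨hy, hyZ⟩
        rcases le_total (dist y x) (r + 1) with h | h
        · exact Or.inl ⟨⟨y, hy, h⟩, fun hz => hyZ ⟨_, hz, rfl⟩, rfl⟩
        · exact Or.inr ⟨hy, h⟩
      · rintro (⟨z, hz, rfl⟩ | ⟨hy, h⟩)
        · refine ⟨z.2.1, ?_⟩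
          rintro ⟨w, hw, hwz⟩
          exact hz (Subtype.ext hwz ▸ hw)
        · refine ⟨hy, ?_⟩
          rintro ⟨w, hw, rfl⟩
          exact not_lt.2 h (show dist (w : X) x < r + 1 from hZU hw)
    rw [this]
    exact (hZ.compl.1.isCompact.image continuous_subtype_val).isClosed.union
      (hF.inter (isClosed_le continuous_const (by fun_prop)))

/-- A closed set `F` which is invariant under enough isometries and has bounded components is, in a
uniform way, locally contained in bounded relatively clopen subsets. -/
theorem exists_uniform_bound_clopen [ProperSpace X] {F K : Set X} (hF : IsClosed F)
    (hK : IsCompact K)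
    (hcov : ∀ x, ∃ g : X ≃ᵢ X, g x ∈ K ∧ g ⁻¹' F = F)
    (hb : ∀ x ∈ F, Bornology.IsBounded (connectedComponentIn F x)) :
    ∃ R₀ : ℝ, 0 ≤ R₀ ∧ ∀ x ∈ F, ∃ V ⊆ F, x ∈ V ∧ (∀ y ∈ V, dist y x ≤ R₀) ∧ IsClosed V ∧
      IsClosed (F \ V) := by
  have h1 : ∀ x, ∃ V ⊆ F, (x ∈ F → x ∈ V) ∧ Bornology.IsBounded V ∧ IsClosed V ∧
      IsClosed (F \ V) := by
    intro x
    by_cases hx : x ∈ F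
    · obtain ⟨V, h1, h2, h3⟩ := exists_bounded_clopen_of_isBounded_component hF hx (hb x hx)
      exact ⟨V, h1, fun _ => h2, h3⟩
    · exact ⟨∅, empty_subset _, fun h => absurd h hx, Bornology.isBounded_empty, isClosed_empty,
        by simpa using hF⟩
  choose V hVF hxV hVb hVc hVc' using h1
  obtain ⟨t, ht, htK⟩ := (hK.inter_left hF).elim_nhds_subcover (fun x => (F \ V x)ᶜ)
    (fun x hx => (hVc' x).isOpen_compl.mem_nhds fun h => h.2 (hxV x hx.1))
  have hd : ∀ x, ∃ d : ℝ, ∀ y ∈ V x, ∀ z ∈ V x, dist y z ≤ d :=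
    fun x => Metric.isBounded_iff.1 (hVb x) |>.imp fun d h y hy z hz => h hy hz
  choose d hd using hd
  refine ⟨∑ x ∈ t, |d x|, Finset.sum_nonneg fun x _ => abs_nonneg _, fun x hx => ?_⟩
  obtain ⟨g, hgK, hgF⟩ := hcov x
  have hgxF : g x ∈ F := by
    rw [← hgF] at hx
    exact hx
  obtain ⟨c, hc, hxc⟩ := mem_iUnion₂.1 (htK ⟨hgxF, hgK⟩)
  have hgV : g x ∈ V c := by
    by_contra h
    exact hxc ⟨hgxF, h⟩
  refine ⟨g ⁻¹' V c, ?_, hgV, fun y hy => ?_, (hVc c).preimage g.continuous, ?_⟩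
  · rw [← hgF]
    exact preimage_mono (hVF c)
  · rw [← g.dist_eq]
    exact (hd c _ hy _ hgV).trans ((le_abs_self _).trans
      (Finset.single_le_sum (f := fun x => |d x|) (fun x _ => abs_nonneg _) hc))
  · nth_rewrite 1 [← hgF]
    rw [← preimage_sdiff]
    exact (hVc' c).preimage g.continuous

/-- On a compact set, the bounded relatively clopen subsets of `F` give rise to a labelling of the
points of `F` by nearby points which is constant at small scale. -/
theorem exists_locally_constant_label {F S : Set X} (hS : IsCompact S) (hF : IsClosed F) {R₀ : ℝ}
    (hR₀ : 0 ≤ R₀)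
    (hV : ∀ x ∈ F, ∃ V ⊆ F, x ∈ V ∧ (∀ y ∈ V, dist y x ≤ R₀) ∧ IsClosed V ∧ IsClosed (F \ V)) :
    ∃ δ > 0, ∃ f : X → X, (∀ x, dist (f x) x ≤ R₀) ∧
      ∀ x ∈ F ∩ S, ∀ y ∈ F ∩ S, dist x y ≤ δ → f x = f y := by
  classical
  have h1 : ∀ x, ∃ V ⊆ F, (x ∈ F → x ∈ V) ∧ (∀ y ∈ V, dist y x ≤ R₀) ∧ IsClosed V ∧
      IsClosed (F \ V) := by
    intro x
    by_cases hx : x ∈ F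
    · obtain ⟨V, h1, h2, h3⟩ := hV x hx
      exact ⟨V, h1, fun _ => h2, h3⟩
    · exact ⟨∅, empty_subset _, fun h => absurd h hx, by simp, isClosed_empty, by simpa using hF⟩
  choose V hVF hxV hVb hVc hVc' using h1
  obtain ⟨t, ht, htS⟩ := (hS.inter_left hF).elim_nhds_subcover (fun x => (F \ V x)ᶜ)
    (fun x hx => (hVc' x).isOpen_compl.mem_nhds fun h => h.2 (hxV x hx.1))
  have hsep : ∀ c, ∃ δ > 0, ∀ x ∈ V c ∩ S, ∀ y ∈ F \ V c, δ < dist x y := by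
    intro c
    obtain ⟨r, hr, h⟩ := Metric.exists_pos_forall_lt_edist (hS.inter_left (hVc c)) (hVc' c)
      (disjoint_left.2 fun x hx hx' => hx'.2 hx.1)
    refine ⟨r, hr, fun x hx y hy => ?_⟩
    have := h x hx y hy
    rw [edist_nndist] at this
    exact_mod_cast this
  choose δ hδ hsep using hsep
  obtain ⟨δ₀, hδ₀, hδ₀'⟩ : ∃ δ₀ > 0, ∀ c ∈ t, δ₀ ≤ δ c := by
    rcases t.eq_empty_or_nonempty with rfl | hne
    · exact ⟨1, one_pos, by simp⟩
    · exact ⟨t.inf' hne δ, (Finset.lt_inf'_iff _).2 fun c _ => hδ c,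
        fun c hc => Finset.inf'_le _ hc⟩
  -- the label of `x` only depends on the members of the finite cover which contain `x`
  let T : X → Finset X := fun x => t.filter fun c => x ∈ V c
  let label : Finset X → X → X := fun s x => if h : s.Nonempty then h.choose else x
  refine ⟨δ₀, hδ₀, fun x => label (T x) x, fun x => ?_, fun x hx y hy hxy => ?_⟩
  · by_cases h : (T x).Nonempty
    · have hc := (Finset.mem_filter.1 h.choose_spec).2
      simp only [label, dif_pos h]
      rw [dist_comm]
      exact hVb _ x hc
    · simpa [label, h] using hR₀
  · have hsub : ∀ x ∈ F ∩ S, ∀ y ∈ F ∩ S, dist x y ≤ δ₀ → T x ⊆ T y := by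
      intro x hx y hy hxy c hc
      obtain ⟨hct, hxc⟩ := Finset.mem_filter.1 hc
      refine Finset.mem_filter.2 ⟨hct, ?_⟩
      by_contra hyc
      exact absurd (hsep c x ⟨hxc, hx.2⟩ y ⟨hy.1, hyc⟩) (not_lt.2 (hxy.trans (hδ₀' c hct)))
    have hT : T x = T y := (hsub x hx y hy hxy).antisymm (hsub y hy x hx (by rwa [dist_comm]))
    have hne : (T y).Nonempty := by
      obtain ⟨c, hc, hyc⟩ := mem_iUnion₂.1 (htS hy)
      refine ⟨c, Finset.mem_filter.2 ⟨hc, ?_⟩⟩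
      by_contra h
      exact hyc ⟨hy.1, h⟩
    simp only [label, hT, dif_pos hne]

/-- A proper metric space homeomorphic to `ℝⁿ` cannot be covered by `m + 1 ≤ n` closed sets with
bounded components which are invariant under a cocompact family of isometries. -/
theorem not_forall_isBounded_connectedComponentIn [ProperSpace X] {n m : ℕ} (hmn : m < n)
    (e : X ≃ₜ EuclideanSpace ℝ (Fin n)) {K : Set X} (hK : IsCompact K)
    (F : Fin (m + 1) → Set X) (hF : ∀ i, IsClosed (F i)) (hFu : ⋃ i, F i = univ)
    (hcov : ∀ x, ∃ g : X ≃ᵢ X, g x ∈ K ∧ ∀ i, g ⁻¹' F i = F i) :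
    ¬ ∀ i, ∀ x ∈ F i, Bornology.IsBounded (connectedComponentIn (F i) x) := by
  intro hb
  have h1 := fun i => exists_uniform_bound_clopen (hF i) hK
    (fun x => (hcov x).imp fun g hg => ⟨hg.1, hg.2 i⟩) (hb i)
  choose R₀ hR₀ hV using h1
  have hR : ∀ i, R₀ i ≤ ∑ j, R₀ j := fun i =>
    Finset.single_le_sum (f := R₀) (fun j _ => hR₀ j) (Finset.mem_univ i)
  refine not_exists_bounded_colouring hmn e hK (fun x => (hcov x).imp fun g hg => hg.1)
    (∑ j, R₀ j) fun S hS => ?_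
  choose δ hδ f hf hfS using fun i => exists_locally_constant_label hS (hF i) (hR₀ i) (hV i)
  have hcol : ∀ x, ∃ i, x ∈ F i := fun x => mem_iUnion.1 (hFu ▸ mem_univ x)
  choose colour hcolour using hcol
  refine ⟨Finset.univ.inf' ⟨0, Finset.mem_univ _⟩ δ, (Finset.lt_inf'_iff _).2 fun i _ => hδ i,
    fun x => f (colour x) x, colour, fun x => (hf _ x).trans (hR _), fun x hx y hy hxy hc => ?_⟩
  show f (colour x) x = f (colour y) y
  rw [← hc]
  exact hfS (colour x) x ⟨hcolour x, hx⟩ y ⟨hc ▸ hcolour y, hy⟩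
    (hxy.trans (Finset.inf'_le _ (Finset.mem_univ _)))

end Labels

/-! ### Deck transformations and properness -/

section Deck

variable {n : ℕ} {X M : Type*}
  [TopologicalSpace X] [ChartedSpace (EuclideanSpace ℝ (Fin n)) X]
  [TopologicalSpace M] [ChartedSpace (EuclideanSpace ℝ (Fin n)) M]

/-- A manifold version of the easy part of the inverse function theorem. -/
theorem contMDiffAt_symm_of_injective_mfderiv (q : OpenPartialHomeomorph X M) {y : X}
    (hy : y ∈ q.source) (hq : ContMDiffAt (𝓡 n) (𝓡 n) 1 q y)
    (hinj : Function.Injective (mfderiv (𝓡 n) (𝓡 n) q y)) :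
    ContMDiffAt (𝓡 n) (𝓡 n) 1 q.symm (q y) := by
  have hd : MDifferentiableAt (𝓡 n) (𝓡 n) q y := hq.mdifferentiableAt one_ne_zero
  let Φ : OpenPartialHomeomorph (EuclideanSpace ℝ (Fin n)) (EuclideanSpace ℝ (Fin n)) :=
    (chartAt _ y).symm.trans (q.trans (chartAt _ (q y)))
  let A : EuclideanSpace ℝ (Fin n) →L[ℝ] EuclideanSpace ℝ (Fin n) := mfderiv (𝓡 n) (𝓡 n) q y
  have hA : A = fderiv ℝ Φ (chartAt (EuclideanSpace ℝ (Fin n)) y y) := by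
    have : A = fderivWithin ℝ (writtenInExtChartAt (𝓡 n) (𝓡 n) y q) (range (𝓡 n))
        (extChartAt (𝓡 n) y y) := hd.mfderiv
    rw [this]
    simp [Φ, writtenInExtChartAt, Function.comp_def]
  have hΦ : ContDiffAt ℝ 1 Φ (chartAt (EuclideanSpace ℝ (Fin n)) y y) := by
    have := (contMDiffAt_iff.1 hq).2
    simpa [Φ, Function.comp_def, contDiffWithinAt_univ] using this
  let B : EuclideanSpace ℝ (Fin n) ≃L[ℝ] EuclideanSpace ℝ (Fin n) :=
    (LinearEquiv.ofInjectiveEndo (A : EuclideanSpace ℝ (Fin n) →ₗ[ℝ] EuclideanSpace ℝ (Fin n))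
      hinj).toContinuousLinearEquiv
  have hB : (B : EuclideanSpace ℝ (Fin n) →L[ℝ] EuclideanSpace ℝ (Fin n)) = A := by
    ext v
    rfl
  have hsymm : Φ.symm (chartAt (EuclideanSpace ℝ (Fin n)) (q y) (q y))
      = chartAt (EuclideanSpace ℝ (Fin n)) y y := by
    simp [Φ, hy]
  have key : ContDiffAt ℝ 1 Φ.symm (chartAt (EuclideanSpace ℝ (Fin n)) (q y) (q y)) := by
    refine Φ.contDiffAt_symm (f₀' := B) ?_ ?_ ?_
    · simp [Φ, hy]
    · rw [hB, hA, hsymm]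
      exact (hΦ.differentiableAt one_ne_zero).hasFDerivAt
    · rwa [hsymm]
  refine contMDiffAt_iff.2 ⟨q.continuousAt_symm (q.map_source hy), ?_⟩
  rw [q.left_inv hy]
  simpa [Φ, Function.comp_def, contDiffWithinAt_univ] using key

/-- A continuous lift of a `C¹` map through a `C¹` local homeomorphism with injective derivatives
is `C¹`. -/
theorem IsLocalHomeomorph.contMDiff_lift {p : X → M} (hp : IsLocalHomeomorph p)
    (hp1 : ContMDiff (𝓡 n) (𝓡 n) 1 p)
    (hinj : ∀ x, Function.Injective (mfderiv (𝓡 n) (𝓡 n) p x)) {g : X → X} (hg : Continuous g)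
    (hpg : ContMDiff (𝓡 n) (𝓡 n) 1 (p ∘ g)) : ContMDiff (𝓡 n) (𝓡 n) 1 g := by
  intro x
  obtain ⟨q, hq, rfl⟩ := hp (g x)
  have h1 := contMDiffAt_symm_of_injective_mfderiv q hq (hp1 (g x)) (hinj (g x))
  have h2 : ContMDiffAt (𝓡 n) (𝓡 n) 1 (q.symm ∘ (q ∘ g)) x := ContMDiffAt.comp x h1 (hpg x)
  refine h2.congr_of_eventuallyEq ?_
  filter_upwards [hg.continuousAt.preimage_mem_nhds (q.open_source.mem_nhds hq)] with z hz
  simp [q.left_inv hz]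

end Deck

section Riemannian

variable {n : ℕ}
  {X : Type*} [MetricSpace X]
  [ChartedSpace (EuclideanSpace ℝ (Fin n)) X]
  [RiemannianBundle (fun x : X => TangentSpace (𝓡 n) x)]
  [IsRiemannianManifold (𝓡 n) X]

/-- A `C¹` map which preserves the norms of tangent vectors does not increase distances. -/
theorem dist_map_le_of_norm_mfderiv {g : X → X} (hg : ContMDiff (𝓡 n) (𝓡 n) 1 g)
    (hn : ∀ (x : X) (v : TangentSpace (𝓡 n) x), ‖mfderiv (𝓡 n) (𝓡 n) g x v‖ = ‖v‖) (x y : X) :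
    dist (g x) (g y) ≤ dist x y := by
  rw [dist_edist, dist_edist]
  refine ENNReal.toReal_mono (edist_ne_top _ _) ?_
  rw [IsRiemannianManifold.out (I := 𝓡 n) (g x) (g y), IsRiemannianManifold.out (I := 𝓡 n) x y]
  refine le_of_forall_gt fun r hr => ?_
  obtain ⟨γ, h0, h1, hγ, hlen, -, -⟩ := exists_lt_locally_constant_of_riemannianEDist_lt hr
    zero_lt_one
  refine lt_of_le_of_lt ?_ hlen
  refine (riemannianEDist_le_pathELength (γ := g ∘ γ) (a := 0) (b := 1)
    (hg.comp hγ).contMDiffOn (by simp [h0]) (by simp [h1]) zero_le_one).trans_eq ?_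
  rw [pathELength_eq_lintegral_mfderiv_Icc, pathELength_eq_lintegral_mfderiv_Icc]
  refine lintegral_congr fun t => ?_
  rw [mfderiv_comp t (hg.mdifferentiableAt one_ne_zero) (hγ.mdifferentiableAt one_ne_zero)]
  have := hn (γ t) (mfderiv 𝓘(ℝ, ℝ) (𝓡 n) γ t 1)
  rw [← ofReal_norm, ← ofReal_norm]
  exact congrArg ENNReal.ofReal this

/-- The distance of a Riemannian manifold is a length distance: if
`dist x z < s + t`, some point is within `s` of `x` and within `t` of `z`. -/
theorem exists_dist_le_dist_lt (n : ℕ) {X : Type*} [MetricSpace X]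
    [ChartedSpace (EuclideanSpace ℝ (Fin n)) X]
    [RiemannianBundle (fun x : X => TangentSpace (𝓡 n) x)] [IsRiemannianManifold (𝓡 n) X]
    {x z : X} {s t : ℝ} (hs : 0 ≤ s) (ht : 0 < t) (h : dist x z < s + t) :
    ∃ w, dist x w ≤ s ∧ dist w z < t := by
  by_cases hxz : dist x z ≤ s
  · exact ⟨z, hxz, by simpa using ht⟩
  push Not at hxz
  have hr : riemannianEDist (𝓡 n) x z < ENNReal.ofReal (s + t) := by
    rw [← IsRiemannianManifold.out (I := 𝓡 n) x z, edist_dist]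
    exact (ENNReal.ofReal_lt_ofReal_iff (by positivity)).2 h
  obtain ⟨γ, h0, h1, hγ, hlen, -, -⟩ := exists_lt_locally_constant_of_riemannianEDist_lt hr
    zero_lt_one
  have hcont : ContinuousOn (fun u => dist x (γ u)) (Icc 0 1) :=
    (continuous_const.dist hγ.continuous).continuousOn
  obtain ⟨u, hu, hus⟩ : s ∈ (fun u => dist x (γ u)) '' Icc 0 1 :=
    intermediate_value_Icc zero_le_one hcont ⟨by simpa [h0] using hs, by simpa [h1] using hxz.le⟩
  refine ⟨γ u, hus.le, ?_⟩
  have hsum : edist x (γ u) + edist (γ u) z < ENNReal.ofReal (s + t) := by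
    refine lt_of_le_of_lt ?_ hlen
    rw [← pathELength_add hu.1 hu.2, IsRiemannianManifold.out (I := 𝓡 n) x (γ u),
      IsRiemannianManifold.out (I := 𝓡 n) (γ u) z]
    exact add_le_add (riemannianEDist_le_pathELength hγ.contMDiffOn h0 rfl hu.1)
      (riemannianEDist_le_pathELength hγ.contMDiffOn rfl h1 hu.2)
  rw [edist_dist, edist_dist, ← ENNReal.ofReal_add dist_nonneg dist_nonneg,
    ENNReal.ofReal_lt_ofReal_iff (by positivity)] at hsum
  have hus' : dist x (γ u) = s := hus
  linarith

/-- A Riemannian manifold with cocompact isometry group is proper: small balls are uniformly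
compact, and the radius of compact balls can be increased by a fixed amount. -/
theorem properSpace_of_cocompact (n : ℕ) {X : Type*} [MetricSpace X]
    [ChartedSpace (EuclideanSpace ℝ (Fin n)) X]
    [RiemannianBundle (fun x : X => TangentSpace (𝓡 n) x)] [IsRiemannianManifold (𝓡 n) X]
    [LocallyCompactSpace X] {K : Set X} (hK : IsCompact K)
    (hcov : ∀ x, ∃ g : X ≃ᵢ X, g x ∈ K) : ProperSpace X := by
  obtain ⟨ε, hε, hKε⟩ := hK.exists_isCompact_cthickening
  have hsmall : ∀ x : X, IsCompact (Metric.closedBall x ε) := by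
    intro x
    obtain ⟨g, hg⟩ := hcov x
    have h1 : IsCompact (Metric.closedBall (g x) ε) :=
      hKε.of_isClosed_subset Metric.isClosed_closedBall
        (Metric.closedBall_subset_cthickening hg ε)
    have h2 := h1.image g.symm.continuous
    rwa [g.symm.image_closedBall, g.symm_apply_apply] at h2
  have hstep : ∀ (x : X) (r : ℝ), 0 ≤ r → IsCompact (Metric.closedBall x r) →
      IsCompact (Metric.closedBall x (r + ε / 4)) := by
    intro x r hr hc
    obtain ⟨t, ht, htr⟩ := hc.elim_nhds_subcover (fun y => Metric.ball y (ε / 4))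
      (fun y _ => Metric.ball_mem_nhds y (by positivity))
    refine (t.isCompact_biUnion fun y _ => hsmall y).of_isClosed_subset
      Metric.isClosed_closedBall fun z hz => ?_
    rw [Metric.mem_closedBall, dist_comm] at hz
    obtain ⟨w, hxw, hwz⟩ := exists_dist_le_dist_lt n (x := x) (z := z) hr (half_pos hε)
      (by linarith)
    obtain ⟨y, hy, hwy⟩ := mem_iUnion₂.1 (htr (Metric.mem_closedBall'.2 hxw))
    refine mem_iUnion₂.2 ⟨y, hy, ?_⟩
    rw [Metric.mem_ball] at hwy
    rw [Metric.mem_closedBall]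
    linarith [dist_triangle z w y, dist_comm z w]
  have hall : ∀ (x : X) (N : ℕ), IsCompact (Metric.closedBall x (N * (ε / 4))) := by
    intro x N
    induction N with
    | zero => simp
    | succ N ih =>
      have := hstep x _ (by positivity) ih
      rwa [Nat.cast_succ, add_mul, one_mul]
  refine ⟨fun x r => ?_⟩
  obtain ⟨N, hN⟩ := exists_nat_ge (r / (ε / 4))
  rw [div_le_iff₀ (by positivity)] at hN
  exact (hall x N).of_isClosed_subset Metric.isClosed_closedBall
    (Metric.closedBall_subset_closedBall hN)

end Riemannian

section Covering

/-- The deck transformations of a simply connected covering act transitively on the fibres. -/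
theorem IsCoveringMap.exists_deck_homeomorph {X M : Type*} [TopologicalSpace X]
    [TopologicalSpace M] [SimplyConnectedSpace X] [LocallyPathConnectedSpace X] {p : X → M}
    (hp : IsCoveringMap p) {x y : X} (hxy : p x = p y) :
    ∃ g : X ≃ₜ X, g x = y ∧ p ∘ g = p := by
  have hlift := fun a b (h : p b = p a) =>
    hp.existsUnique_continuousMap_lifts (⟨p, hp.continuous⟩ : C(X, M)) a b h
  obtain ⟨G, hG, -⟩ := hlift x y hxy.symm
  obtain ⟨H, hH, -⟩ := hlift y x hxy
  have hcomp : ∀ a b (A B : C(X, X)), A a = b → p ∘ A = p → B b = a → p ∘ B = p →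
      B.comp A = ContinuousMap.id X := by
    intro a b A B hA hpA hB hpB
    refine (hlift a a rfl).unique ⟨by simp [hA, hB], ?_⟩ ⟨rfl, rfl⟩
    rw [ContinuousMap.coe_comp, ← Function.comp_assoc, hpB, hpA]
    rfl
  have h1 := hcomp x y G H hG.1 hG.2 hH.1 hH.2
  have h2 := hcomp y x H G hH.1 hH.2 hG.1 hG.2
  exact ⟨⟨⟨G, H, fun z => DFunLike.congr_fun h1 z, fun z => DFunLike.congr_fun h2 z⟩,
    G.continuous, H.continuous⟩, hG.1, hG.2⟩

/-- An open surjection from a locally compact space onto a compact space maps some compact set onto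
the target. -/
theorem IsOpenMap.exists_isCompact_image_eq_univ {X M : Type*} [TopologicalSpace X]
    [TopologicalSpace M] [LocallyCompactSpace X] [CompactSpace M] {p : X → M} (hp : IsOpenMap p)
    (hsurj : Function.Surjective p) : ∃ K : Set X, IsCompact K ∧ p '' K = univ := by
  choose s hs using hsurj
  choose C hC hCs using fun a : M => exists_compact_mem_nhds (s a)
  obtain ⟨t, -, ht⟩ := (isCompact_univ (X := M)).elim_nhds_subcover (fun a => p '' C a)
    (fun a _ => by simpa [hs a] using hp.image_mem_nhds (hCs a))
  refine ⟨⋃ a ∈ t, C a, t.isCompact_biUnion fun a _ => hC a, ?_⟩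
  rw [image_iUnion₂]
  exact univ_subset_iff.1 ht

variable {n : ℕ} {X M : Type*} [MetricSpace X] [ChartedSpace (EuclideanSpace ℝ (Fin n)) X]
  [RiemannianBundle (fun x : X => TangentSpace (𝓡 n) x)] [IsRiemannianManifold (𝓡 n) X]
  [TopologicalSpace M] [ChartedSpace (EuclideanSpace ℝ (Fin n)) M]
  [RiemannianBundle (fun x : M => TangentSpace (𝓡 n) x)]

/-- The deck transformations of a universal Riemannian cover do not increase distances. -/
theorem IsUniversalRiemannianCover.dist_deck_le {p : X → M} (hp : IsUniversalRiemannianCover n p)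
    {g : X → X} (hg : Continuous g) (hpg : p ∘ g = p) (x y : X) : dist (g x) (g y) ≤ dist x y := by
  have hp1 : ContMDiff (𝓡 n) (𝓡 n) 1 p := hp.contMDiff.of_le (by norm_cast)
  have hinj : ∀ x, Function.Injective (mfderiv (𝓡 n) (𝓡 n) p x) := by
    intro x
    rw [injective_iff_map_eq_zero]
    intro v hv
    have := hp.norm_mfderiv x v
    rw [hv, norm_zero] at this
    exact norm_eq_zero.1 this.symm
  have hg1 : ContMDiff (𝓡 n) (𝓡 n) 1 g :=
    hp.isCoveringMap.isLocalHomeomorph.contMDiff_lift hp1 hinj hg (by rwa [hpg])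
  refine dist_map_le_of_norm_mfderiv hg1 (fun x v => ?_) x y
  rw [← hp.norm_mfderiv (g x) (mfderiv (𝓡 n) (𝓡 n) g x v), ← hp.norm_mfderiv x v]
  have hcomp := mfderiv_comp x (hp1.mdifferentiableAt (x := g x) one_ne_zero)
    (hg1.mdifferentiableAt one_ne_zero)
  -- the target `p (g x)` has to be generalized, since tangent spaces depend on it
  have hcongr : ∀ f : X → M, f = p →
      ‖mfderiv (𝓡 n) (𝓡 n) f x v‖ = ‖mfderiv (𝓡 n) (𝓡 n) p x v‖ := by
    rintro f rfl
    rfl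
  rw [← hcongr _ hpg, hcomp]
  rfl

/-- The deck transformations of a universal Riemannian cover are isometries, and they act
transitively on the fibres. -/
theorem IsUniversalRiemannianCover.exists_deck_isometry {p : X → M}
    (hp : IsUniversalRiemannianCover n p) {x y : X} (hxy : p x = p y) :
    ∃ g : X ≃ᵢ X, g x = y ∧ p ∘ g = p := by
  have := hp.simplyConnectedSpace
  have : LocallyPathConnectedSpace X :=
    ChartedSpace.locallyPathConnectedSpace (EuclideanSpace ℝ (Fin n)) X
  obtain ⟨g, hgx, hpg⟩ := hp.isCoveringMap.exists_deck_homeomorph hxy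
  have hpg' : p ∘ g.symm = p := by
    nth_rewrite 1 [← hpg]
    rw [Function.comp_assoc, g.self_comp_symm, Function.comp_id]
  refine ⟨⟨g.toEquiv, Isometry.of_dist_eq fun a b => le_antisymm
    (hp.dist_deck_le g.continuous hpg a b) ?_⟩, hgx, hpg⟩
  simpa using hp.dist_deck_le g.symm.continuous hpg' (g a) (g b)

end Covering

/-! ### Clusters which are tilings -/

/-- Tilings cannot occur as minimizing `m`-bubble clusters, `m < n`, in a compact Riemannian
`n`-manifold `M` whose universal cover `X` is homeomorphic to `ℝⁿ`. -/
theorem mainTheorem5 (n m : ℕ) (hmn : m < n)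
    -- a compact Riemannian `n`-manifold `M` (without boundary)
    {M : Type*} [MetricSpace M] [MeasurableSpace M] [BorelSpace M] [CompactSpace M]
    [ChartedSpace (EuclideanSpace ℝ (Fin n)) M] [IsManifold (𝓡 n) ∞ M]
    [RiemannianBundle (fun x : M => TangentSpace (𝓡 n) x)]
    [IsContMDiffRiemannianBundle (𝓡 n) ∞ (EuclideanSpace ℝ (Fin n))
      (fun x : M => TangentSpace (𝓡 n) x)]
    [IsRiemannianManifold (𝓡 n) M]
    -- its universal cover `X`, with the lifted Riemannian metric
    {X : Type*} [MetricSpace X]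
    [ChartedSpace (EuclideanSpace ℝ (Fin n)) X] [IsManifold (𝓡 n) ∞ X]
    [RiemannianBundle (fun x : X => TangentSpace (𝓡 n) x)]
    [IsContMDiffRiemannianBundle (𝓡 n) ∞ (EuclideanSpace ℝ (Fin n))
      (fun x : X => TangentSpace (𝓡 n) x)]
    [IsRiemannianManifold (𝓡 n) X]
    (p : X → M) (hp : IsUniversalRiemannianCover n p)
    (hX : Nonempty (X ≃ₜ EuclideanSpace ℝ (Fin n)))
    -- a minimizing `m`-bubble cluster
    (R : Fin (m + 1) → Set M) (hR : IsMinimizingBubbleCluster n m R) :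
    ¬ IsTiling p R := by
  intro hT
  obtain ⟨e⟩ := hX
  have : LocallyCompactSpace X := ChartedSpace.locallyCompactSpace (EuclideanSpace ℝ (Fin n)) X
  obtain ⟨K, hK, hpK⟩ := hp.isCoveringMap.isLocalHomeomorph.isOpenMap.exists_isCompact_image_eq_univ
    hp.surjective
  have hcov : ∀ x, ∃ g : X ≃ᵢ X, g x ∈ K ∧ p ∘ g = p := by
    intro x
    obtain ⟨k, hk, hkx⟩ : p x ∈ p '' K := hpK ▸ mem_univ _
    obtain ⟨g, hgx, hpg⟩ := hp.exists_deck_isometry hkx.symm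
    exact ⟨g, hgx ▸ hk, hpg⟩
  have : ProperSpace X := properSpace_of_cocompact n hK fun x => (hcov x).imp fun g hg => hg.1
  refine not_forall_isBounded_connectedComponentIn hmn e hK (fun i => p ⁻¹' R i)
    (fun i => (hR.isBubbleCluster.isClosed i).preimage hp.isCoveringMap.continuous) ?_ ?_ ?_
  · rw [← preimage_iUnion, hR.isBubbleCluster.iUnion_eq, preimage_univ]
  · intro x
    obtain ⟨g, hgK, hpg⟩ := hcov x
    refine ⟨g, hgK, fun i => ?_⟩
    rw [← preimage_comp, hpg]
  · intro i x hx
    exact Metric.isBounded_iff_ediam_ne_top.2 (hT _ ⟨i, x, hx, rfl⟩).ne
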